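/- Let $\mathbb K\in\{\mathbb R,\mathbb C\}$; all algebras and Banach spaces are over $\mathbb K$, and $B(X)$ denotes the bounded linear operators on $X$. A Banach algebra dynamical system $(A,G,\alpha)$ consists of a Banach algebra $A$, a locally compact Hausdorff group $G$ and a strongly continuous representation $\alpha:G\to\mathrm{Aut}(A)$ by bounded algebra automorphisms. A weight on $G$ is a non-zero, submultiplicative, Borel measurable function $\omega:G\to[0,\infty)$. If $\alpha$ is uniformly bounded, i.e. $\sup_{r\in G}\|\alpha_r\|<\infty$, and $\mu_G$ is a fixed left Haar measure, then $L^1(G,A,\omega;\alpha)$ denotes the completion of the space $C_c(G,A)$ of continuous compactly supported functions in the norm $\|f\|_{1,\omega}=\int_G\|f(r)\|\,\omega(r)\,d\mu_G(r)$, with the continuous multiplication extending the twisted convolution $[f*g](s)=\int_G f(r)\,\alpha_r(g(r^{-1}s))\,d\mu_G(r)$. A (anti-)representation $T$ of an algebra $E$ on $X$ is a linear (anti-)multiplicative map $T:E\to B(X)$; it is non-degenerate if the span of $T(E)X$ is dense in $X$. (Anti-)representations $U$ of a group satisfy $U_e=\mathrm{id}_X$. Two maps into $B(X)$ commute if each value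 of the one commutes with each value of the other; pairs $(\pi_1,U_1)$ and $(\pi_2,U_2)$ commute if each of $\pi_1,U_1$ commutes with each of $\pi_2,U_2$. **Theorem.** Let $(A,G,\alpha)$ and $(B,H,\beta)$ be Banach algebra dynamical systems, where $A$ and $B$ have bounded two-sided approximate identities and $\alpha$ and $\beta$ are uniformly bounded. Let $\omega$ be a weight on $G$, $\eta$ a weight on $H$, and $X$ a Banach space. Consider pairs $(\pi^m,U^m)$ and $(\pi^a,U^a)$ with the following properties. * $\pi^m:A\to B(X)$ is a non-degenerate bounded representation, $U^m:G\to B(X)$ is a strongly continuous representation, $U^m_r\pi^m(a)(U^m_r)^{-1}=\pi^m(\alpha_r(a))$ for all $a\in A$, $r\in G$, and there is a constant $C_{U^m}$ with $\|U^m_r\|\le C_{U^m}\,\omega(r)$ for all $r\in G$. * $\pi^a:B\to B(X)$ is a non-degenerate bounded anti-representation, $U^a:H\to B(X)$ is a strongly continuous anti-representation, $U^a_s\pi^a(b)(U^a_s)^{-1}=\pi^a(\beta_{s^{-1}}(b))$ for all $b\in B$, $s\in H$, and there is a constant $C_{U^a}$ with $\|U^a_s\|\le C_{U^a}\,\eta(s)$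 for all $s\in H$. (1) If, in addition, $(\pi^m,U^m)$ and $(\pi^a,U^a)$ commute, then $$T^m(f)=\int_G\pi^m(f(r))\,U^m_r\,d\mu_G(r)\quad(f\in C_c(G,A))$$ (a strong operator integral) determines a unique bounded linear map $T^m:L^1(G,A,\omega;\alpha)\to B(X)$, and $$T^a(g)=\int_H U^a_s\,\pi^a(g(s))\,d\mu_H(s)\quad(g\in C_c(H,B))$$ determines a unique bounded linear map $T^a:L^1(H,B,\eta;\beta)\to B(X)$. Moreover, $T^m$ is a non-degenerate bounded representation, $T^a$ is a non-degenerate bounded anti-representation, and $T^m$ and $T^a$ commute. (2) Conversely, let $T^m$ be a non-degenerate bounded representation of $L^1(G,A,\omega;\alpha)$ on $X$ and $T^a$ a non-degenerate bounded anti-representation of $L^1(H,B,\eta;\beta)$ on $X$ such that $T^m$ and $T^a$ commute. Then there are a unique pair $(\pi^m,U^m)$ and a unique pair $(\pi^a,U^a)$ with the properties listed in the two bullet points above for which $T^m$ and $T^a$ are given by the formulas in (1), and these two pairs necessarily commute. (For $(A,G,\alpha)=(B,H,\beta)$ and $\omega=\eta$, this describes the non-degenerate bimodules over $L^1(G,A,\omega;\alpha)$.)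 -/

import Mathlib

open MeasureTheory Filter Topology
open scoped NNReal CompactlySupported

noncomputable section

namespace BeurlingBimodule

/-! ### Banach algebra dynamical systems, approximate identities -/

section Systems

variable (𝕜 G A : Type*) [RCLike 𝕜] [Group G] [TopologicalSpace G]
  [NonUnitalNormedRing A] [NormedSpace 𝕜 A]

/-- A Banach algebra dynamical system `(A, G, α)`: a strongly continuous representation `α` of the
topological group `G` on the Banach algebra `A` by bounded algebra automorphisms
(each `α r` is invertible with inverse `α r⁻¹`, since `α` is a monoid homomorphism on `G`). -/
structure DynamicalSystem where
  /-- the action, `r ↦ α r` -/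
  act : G →* (A →L[𝕜] A)
  act_mul : ∀ (r : G) (a b : A), act r (a * b) = act r a * act r b
  continuous_act : ∀ a : A, Continuous fun r : G => act r a

variable {𝕜 G A}

/-- `α` is uniformly bounded: `sup_r ‖α r‖ < ∞`. -/
def DynamicalSystem.UniformlyBounded (α : DynamicalSystem 𝕜 G A) : Prop :=
  ∃ C : ℝ, ∀ r : G, ‖α.act r‖ ≤ C

/-- `A` has a bounded two-sided approximate identity (a norm-bounded net, encoded by the filter of
its tails, that is an approximate identity on both sides). -/
def HasBoundedApproxIdentity (A : Type*) [NonUnitalNormedRing A] : Prop :=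
  ∃ l : Filter A, l.IsApproximateUnit ∧ ∃ M : ℝ, ∀ᶠ u in l, ‖u‖ ≤ M

theorem DynamicalSystem.continuous_uncurry (α : DynamicalSystem 𝕜 G A)
    (hα : α.UniformlyBounded) : Continuous fun p : G × A => α.act p.1 p.2 := by
  obtain ⟨C, hC⟩ := hα
  have h := continuous_prod_of_continuous_lipschitzWith
    (fun p : A × G => α.act p.2 p.1) C.toNNReal (fun a => α.continuous_act a)
    (fun r => (α.act r).lipschitz.weaken (by
      rw [← NNReal.coe_le_coe]; exact (hC r).trans (Real.le_coe_toNNReal C)))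
  exact h.comp continuous_swap

end Systems

/-! ### Weights -/

/-- A weight on `G`: a Borel measurable, submultiplicative, non-zero function `G → [0, ∞)`. -/
structure Weight (G : Type*) [Group G] [MeasurableSpace G] where
  toFun : G → ℝ≥0
  measurable_toFun : Measurable toFun
  toFun_ne_zero : toFun ≠ 0
  toFun_mul_le : ∀ r s : G, toFun (r * s) ≤ toFun r * toFun s

instance (G : Type*) [Group G] [MeasurableSpace G] : CoeFun (Weight G) fun _ => G → ℝ≥0 :=
  ⟨Weight.toFun⟩

section Beurling

variable {G : Type*} [Group G] [TopologicalSpace G] [IsTopologicalGroup G] [LocallyCompactSpace G]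
  [T2Space G] [MeasurableSpace G] [BorelSpace G]

theorem Weight.pos {G : Type*} [Group G] [MeasurableSpace G] (ω : Weight G) (s : G) : 0 < ω s := by
  obtain ⟨t, ht⟩ := Function.ne_iff.mp ω.toFun_ne_zero
  by_contra h
  have hs : ω s = 0 := le_antisymm (not_lt.mp h) zero_le
  have := ω.toFun_mul_le s (s⁻¹ * t)
  rw [mul_inv_cancel_left, hs, zero_mul] at this
  exact ht (le_antisymm this zero_le)

/-- A weight is locally bounded. -/
theorem Weight.exists_nhds_le (ω : Weight G) (μ : Measure G) [μ.IsHaarMeasure] [μ.Regular]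
    (s : G) : ∃ C : ℝ≥0, ∀ᶠ t in 𝓝 s, ω t ≤ C := by
  let K : TopologicalSpace.PositiveCompacts G := Classical.arbitrary _
  let E : ℕ → Set G := fun n => {t | ω t ≤ n} ∩ {t | ω t⁻¹ ≤ n}
  have hE : ∀ n, MeasurableSet (E n) := fun n =>
    (measurableSet_le ω.measurable_toFun measurable_const).inter
      (measurableSet_le (ω.measurable_toFun.comp measurable_inv) measurable_const)
  have hEU : ⋃ n, E n = Set.univ := by
    refine Set.eq_univ_of_forall fun t => Set.mem_iUnion.2 ?_
    obtain ⟨n, hn⟩ := exists_nat_ge (max (ω t) (ω t⁻¹))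
    exact ⟨n, (le_max_left _ _).trans hn, (le_max_right _ _).trans hn⟩
  obtain ⟨n, hn⟩ : ∃ n : ℕ, 0 < μ (interior K ∩ E n) := by
    by_contra! hcon
    simp_rw [nonpos_iff_eq_zero, ← measure_iUnion_null_iff, ← Set.inter_iUnion, hEU,
      Set.inter_univ] at hcon
    exact hcon.not_gt <| isOpen_interior.measure_pos _ K.interior_nonempty
  have hst := Measure.div_mem_nhds_one_of_haar_pos_ne_top μ (interior K ∩ E n)
    (isOpen_interior.measurableSet.inter (hE n)) hn
    (mt (measure_mono_top <| Set.inter_subset_left.trans interior_subset) K.isCompact.measure_ne_top)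
  refine ⟨ω s * (n * n), ?_⟩
  have hcont : Tendsto (fun t : G => s⁻¹ * t) (𝓝 s) (𝓝 1) := by
    have : Continuous fun t : G => s⁻¹ * t := by fun_prop
    simpa using this.tendsto s
  filter_upwards [hcont hst] with t ht
  obtain ⟨x, hx, y, hy, hxy⟩ := Set.mem_div.1 ht
  have h1 : t = s * (x * y⁻¹) := by rw [← div_eq_mul_inv, hxy]; group
  rw [h1]
  refine (ω.toFun_mul_le _ _).trans (mul_le_mul_right ((ω.toFun_mul_le _ _).trans ?_) _)
  exact mul_le_mul' hx.2.1 hy.2.2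

variable (μ : Measure G) [μ.IsHaarMeasure] [μ.Regular] (ω : Weight G)

/-- The measure `ω dμ` is finite on compact sets. -/
theorem Weight.isFiniteMeasureOnCompacts :
    IsFiniteMeasureOnCompacts (μ.withDensity fun s => (ω s : ENNReal)) := by
  refine ⟨fun K hK => ?_⟩
  refine hK.induction_on (p := fun K => (μ.withDensity fun s => (ω s : ENNReal)) K < ⊤)
    (by simp) (fun s t hst ht => (measure_mono hst).trans_lt ht)
    (fun s t hs ht => (measure_union_le s t).trans_lt (ENNReal.add_lt_top.2 ⟨hs, ht⟩)) ?_
  intro x _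
  obtain ⟨C, hC⟩ := ω.exists_nhds_le μ x
  obtain ⟨L, hL, hLx⟩ := exists_compact_mem_nhds x
  obtain ⟨V, hVsub, hV, hxV⟩ := mem_nhds_iff.1 (Filter.inter_mem hC hLx)
  refine ⟨V, mem_nhdsWithin_of_mem_nhds (hV.mem_nhds hxV), ?_⟩
  rw [withDensity_apply _ hV.measurableSet]
  calc ∫⁻ s in V, (ω s : ENNReal) ∂μ ≤ ∫⁻ _ in V, (C : ENNReal) ∂μ :=
        setLIntegral_mono measurable_const fun s hs => by
          exact_mod_cast (hVsub hs).1
    _ = C * μ V := by simp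
    _ < ⊤ := ENNReal.mul_lt_top ENNReal.coe_lt_top
        ((measure_mono fun s hs => (hVsub hs).2).trans_lt hL.measure_lt_top)

/-! ### The weighted space `L¹(G, A, ω)` -/

section Space

variable {A : Type*} [NormedAddCommGroup A]

theorem Weight.integral_mul_eq (φ : G → ℝ) :
    ∫ s, φ s * (ω s : ℝ) ∂μ = ∫ s, φ s ∂(μ.withDensity fun s => (ω s : ENNReal)) := by
  rw [integral_withDensity_eq_integral_smul ω.measurable_toFun]
  exact integral_congr_ae (.of_forall fun s => by simp [NNReal.smul_def, mul_comm])

theorem Weight.integrable_mul (φ : G → ℝ) (hφ : Continuous φ) (h : HasCompactSupport φ) :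
    Integrable (fun s => φ s * (ω s : ℝ)) μ := by
  have := ω.isFiniteMeasureOnCompacts μ
  have h1 : Integrable φ (μ.withDensity fun s => (ω s : ENNReal)) :=
    hφ.integrable_of_hasCompactSupport h
  rw [integrable_withDensity_iff_integrable_smul ω.measurable_toFun] at h1
  exact h1.congr (.of_forall fun s => by simp [NNReal.smul_def, mul_comm])

variable (A) in
/-- `C_c(G, A)` as it is normed by `‖h‖_{1, ω} = ∫ ‖h(s)‖ ω(s) dμ(s)`. -/
def WeightedCc (_μ : Measure G) (_ω : Weight G) : Type _ := C_c(G, A)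

instance : AddCommGroup (WeightedCc A μ ω) := inferInstanceAs (AddCommGroup C_c(G, A))

instance {𝕜 : Type*} [RCLike 𝕜] [NormedSpace 𝕜 A] : Module 𝕜 (WeightedCc A μ ω) :=
  inferInstanceAs (Module 𝕜 C_c(G, A))

instance : FunLike (WeightedCc A μ ω) G A := inferInstanceAs (FunLike C_c(G, A) G A)

variable {μ ω} in
theorem WeightedCc.continuous (f : WeightedCc A μ ω) : Continuous f :=
  (show C_c(G, A) from f).toContinuousMap.continuous

variable {μ ω} in
theorem WeightedCc.hasCompactSupport (f : WeightedCc A μ ω) : HasCompactSupport f :=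
  CompactlySupportedContinuousMap.hasCompactSupport' f

variable {μ ω} in
theorem WeightedCc.integrable_norm_mul (f : WeightedCc A μ ω) :
    Integrable (fun s => ‖f s‖ * (ω s : ℝ)) μ :=
  ω.integrable_mul μ _ f.continuous.norm f.hasCompactSupport.norm

instance : Norm (WeightedCc A μ ω) := ⟨fun h => ∫ s, ‖h s‖ * (ω s : ℝ) ∂μ⟩

variable {μ ω} in
theorem WeightedCc.norm_def (h : WeightedCc A μ ω) : ‖h‖ = ∫ s, ‖h s‖ * (ω s : ℝ) ∂μ := rfl

instance : NormedAddCommGroup (WeightedCc A μ ω) :=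
  AddGroupNorm.toNormedAddCommGroup
    { toFun := fun h => ‖h‖
      map_zero' := by
        rw [WeightedCc.norm_def]
        have : ∀ s, (0 : WeightedCc A μ ω) s = 0 := fun _ => rfl
        simp [this]
      add_le' := fun f g => by
        simp only [WeightedCc.norm_def]
        rw [← integral_add f.integrable_norm_mul g.integrable_norm_mul]
        refine integral_mono (f + g).integrable_norm_mul
          (f.integrable_norm_mul.add g.integrable_norm_mul) fun s => ?_
        have : (f + g) s = f s + g s := rfl
        simp only [this, ← add_mul]
        exact mul_le_mul_of_nonneg_right (norm_add_le _ _) (ω s).coe_nonneg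
      neg' := fun f => by
        simp only [WeightedCc.norm_def]
        have : ∀ s, (-f) s = -(f s) := fun _ => rfl
        simp [this]
      eq_zero_of_map_eq_zero' := fun f hf => by
        replace hf : ∫ s, ‖f s‖ * (ω s : ℝ) ∂μ = 0 := hf
        rw [integral_eq_zero_iff_of_nonneg (fun s => mul_nonneg (norm_nonneg _) (ω s).coe_nonneg)
          f.integrable_norm_mul] at hf
        have hae : (f : G → A) =ᵐ[μ] fun _ => 0 := by
          filter_upwards [hf] with s hs
          have := (mul_eq_zero.1 hs).resolve_right
            (by exact_mod_cast (ω.pos s).ne')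
          simpa using this
        have := (f.continuous.ae_eq_iff_eq μ continuous_const).1 hae
        exact DFunLike.coe_injective this }

instance {𝕜 : Type*} [RCLike 𝕜] [NormedSpace 𝕜 A] : NormedSpace 𝕜 (WeightedCc A μ ω) where
  norm_smul_le c f := by
    simp only [WeightedCc.norm_def]
    rw [← integral_const_mul]
    have : ∀ s, (c • f) s = c • f s := fun _ => rfl
    simp [this, norm_smul, mul_assoc]

/-- The Banach space `L¹(G, A, ω)`: the completion of `C_c(G, A)` in `‖·‖_{1, ω}`. -/
abbrev BeurlingSpace (A : Type*) [NormedAddCommGroup A] (μ : Measure G) [μ.IsHaarMeasure]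
    [μ.Regular] (ω : Weight G) : Type _ :=
  UniformSpace.Completion (WeightedCc A μ ω)

variable (𝕜 : Type*) [RCLike 𝕜] [NormedSpace 𝕜 A]

/-- The canonical embedding of `C_c(G, A)` in `L¹(G, A, ω)`. -/
def ofCc : WeightedCc A μ ω →L[𝕜] BeurlingSpace A μ ω := UniformSpace.Completion.toComplL

end Space

/-! ### Twisted convolution and the generalized Beurling algebra -/

section Algebra

variable {𝕜 A : Type*} [RCLike 𝕜] [NonUnitalNormedRing A] [NormedSpace ℝ A] [NormedSpace 𝕜 A]
  [IsScalarTower ℝ 𝕜 A] [IsScalarTower 𝕜 A A] [SMulCommClass 𝕜 A A] [CompleteSpace A]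

namespace DynamicalSystem

variable (α : DynamicalSystem 𝕜 G A)

theorem continuous_twist (hα : α.UniformlyBounded) {f g : G → A} (hf : Continuous f) (hg : Continuous g) :
    Continuous fun p : G × G => f p.2 * α.act p.2 (g (p.2⁻¹ * p.1)) := by
  refine (hf.comp continuous_snd).mul ?_
  exact (α.continuous_uncurry hα).comp
    (continuous_snd.prodMk (hg.comp (continuous_snd.inv.mul continuous_fst)))

theorem twist_eq_zero {f g : G → A} {s r : G} (h : ¬ (r ∈ tsupport f ∧ r⁻¹ * s ∈ tsupport g)) :
    f r * α.act r (g (r⁻¹ * s)) = 0 := by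
  rcases not_and_or.1 h with h | h
  · rw [image_eq_zero_of_notMem_tsupport h, zero_mul]
  · rw [image_eq_zero_of_notMem_tsupport h, map_zero, mul_zero]

theorem integrable_twist (hα : α.UniformlyBounded) {f g : G → A} (hf : Continuous f) (hfc : HasCompactSupport f)
    (hg : Continuous g) (s : G) :
    Integrable (fun r => f r * α.act r (g (r⁻¹ * s))) μ := by
  refine Continuous.integrable_of_hasCompactSupport
    ((α.continuous_twist hα hf hg).comp (continuous_const.prodMk continuous_id)) ?_
  exact hfc.mono fun r hr h => hr (by simp [h])

/-- Twisted convolution on `C_c(G, A)`: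
`[f * g](s) = ∫ f(r) α_r(g(r⁻¹ s)) dμ(r)`. -/
def conv (hα : α.UniformlyBounded) (f g : WeightedCc A μ ω) : WeightedCc A μ ω :=
  (⟨⟨fun s => ∫ r, f r * α.act r (g (r⁻¹ * s)) ∂μ, by
      rw [← continuousOn_univ]
      refine continuousOn_integral_of_compact_support (k := tsupport f) f.hasCompactSupport
        (α.continuous_twist hα f.continuous g.continuous).continuousOn ?_
      intro s r _ hr
      exact α.twist_eq_zero fun h => hr h.1⟩, by
      refine HasCompactSupport.intro
        (f.hasCompactSupport.isCompact.mul g.hasCompactSupport.isCompact) fun s hs => ?_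
      refine integral_eq_zero_of_ae (.of_forall fun r => ?_)
      refine α.twist_eq_zero fun h => hs ?_
      exact Set.mem_mul.2 ⟨r, h.1, r⁻¹ * s, h.2, by group⟩⟩ : C_c(G, A))

theorem conv_apply (hα : α.UniformlyBounded) (f g : WeightedCc A μ ω) (s : G) :
    α.conv μ ω hα f g s = ∫ r, f r * α.act r (g (r⁻¹ * s)) ∂μ := rfl

theorem norm_conv_le (hα : α.UniformlyBounded) {C : ℝ} (hC : ∀ r, ‖α.act r‖ ≤ C) (f g : WeightedCc A μ ω) :
    ‖α.conv μ ω hα f g‖ ≤ C * ‖f‖ * ‖g‖ := by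
  have hC0 : 0 ≤ C := (norm_nonneg _).trans (hC 1)
  have hfin := ω.isFiniteMeasureOnCompacts μ
  let ν := μ.withDensity fun s => (ω s : ENNReal)
  let Φ : G → G → ℝ := fun s r => ‖f r‖ * ‖g (r⁻¹ * s)‖
  have hΦ : Continuous Φ.uncurry :=
    (f.continuous.norm.comp continuous_snd).mul
      (g.continuous.norm.comp (continuous_snd.inv.mul continuous_fst))
  have hΦs : HasCompactSupport Φ.uncurry := by
    refine HasCompactSupport.intro
      ((f.hasCompactSupport.isCompact.mul g.hasCompactSupport.isCompact).prod
        f.hasCompactSupport.isCompact) ?_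
    rintro ⟨s, r⟩ h
    by_cases h1 : r ∈ tsupport f
    · by_cases h2 : r⁻¹ * s ∈ tsupport g
      · exact absurd ⟨Set.mem_mul.2 ⟨r, h1, r⁻¹ * s, h2, by group⟩, h1⟩ h
      · simp [Φ, Function.uncurry, image_eq_zero_of_notMem_tsupport h2]
    · simp [Φ, Function.uncurry, image_eq_zero_of_notMem_tsupport h1]
  have hΦ2 : Continuous fun s => ∫ r, Φ s r ∂μ := by
    rw [← continuousOn_univ]
    refine continuousOn_integral_of_compact_support (k := tsupport f) f.hasCompactSupport
      hΦ.continuousOn fun s r _ hr => ?_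
    simp [Φ, image_eq_zero_of_notMem_tsupport hr]
  have hΦ2s : HasCompactSupport fun s => ∫ r, Φ s r ∂μ := by
    refine HasCompactSupport.intro (hΦs.isCompact.image continuous_fst) fun s hs => ?_
    refine integral_eq_zero_of_ae (.of_forall fun r => ?_)
    exact image_eq_zero_of_notMem_tsupport (f := Φ.uncurry) fun h => hs ⟨(s, r), h, rfl⟩
  have hpt : ∀ s, ‖α.conv μ ω hα f g s‖ ≤ C * ∫ r, Φ s r ∂μ := fun s => by
    rw [conv_apply, ← integral_const_mul]
    refine norm_integral_le_of_norm_le ?_ (.of_forall fun r => ?_)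
    · refine Integrable.const_mul (Continuous.integrable_of_hasCompactSupport
        (hΦ.comp (continuous_const.prodMk continuous_id)) ?_) _
      exact f.hasCompactSupport.mono fun r hr h => hr (by simp [Φ, h])
    · calc ‖f r * α.act r (g (r⁻¹ * s))‖ ≤ ‖f r‖ * (C * ‖g (r⁻¹ * s)‖) :=
            (norm_mul_le _ _).trans (mul_le_mul_of_nonneg_left
              ((α.act r).le_of_opNorm_le (hC r) _) (norm_nonneg _))
        _ = C * Φ s r := by simp only [Φ]; ring
  calc ‖α.conv μ ω hα f g‖
      ≤ ∫ s, (C * ∫ r, Φ s r ∂μ) * (ω s : ℝ) ∂μ := by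
        rw [WeightedCc.norm_def]
        refine integral_mono (WeightedCc.integrable_norm_mul _)
          (ω.integrable_mul μ _ (hΦ2.const_mul C) (hΦ2s.mul_left)) fun s => ?_
        exact mul_le_mul_of_nonneg_right (hpt s) (ω s).coe_nonneg
    _ = C * ∫ s, ∫ r, Φ s r ∂μ ∂ν := by
        rw [ω.integral_mul_eq μ, integral_const_mul]
    _ = C * ∫ r, ∫ s, Φ s r ∂ν ∂μ := by
        rw [integral_integral_swap_of_hasCompactSupport hΦ hΦs]
    _ ≤ C * ∫ r, (‖f r‖ * (ω r : ℝ)) * ‖g‖ ∂μ := by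
        refine mul_le_mul_of_nonneg_left ?_ hC0
        refine integral_mono_of_nonneg (.of_forall fun r => integral_nonneg fun s =>
          mul_nonneg (norm_nonneg _) (norm_nonneg _)) (f.integrable_norm_mul.mul_const _)
          (.of_forall fun r => ?_)
        have hgr : Continuous fun s => ‖g (r⁻¹ * s)‖ :=
          g.continuous.norm.comp (continuous_const.mul continuous_id)
        calc ∫ s, Φ s r ∂ν = ‖f r‖ * ∫ s, ‖g (r⁻¹ * s)‖ * (ω s : ℝ) ∂μ := by
              simp only [Φ, ν]
              rw [integral_const_mul, ω.integral_mul_eq μ]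
          _ = ‖f r‖ * ∫ s, ‖g s‖ * (ω (r * s) : ℝ) ∂μ := by
              congr 1
              rw [← integral_mul_left_eq_self _ r]
              simp
          _ ≤ ‖f r‖ * ∫ s, (ω r : ℝ) * (‖g s‖ * (ω s : ℝ)) ∂μ := by
              refine mul_le_mul_of_nonneg_left ?_ (norm_nonneg _)
              refine integral_mono_of_nonneg (.of_forall fun s =>
                mul_nonneg (norm_nonneg _) (ω _).coe_nonneg) (g.integrable_norm_mul.const_mul _)
                (.of_forall fun s => ?_)
              have : (ω (r * s) : ℝ) ≤ ω r * ω s := by exact_mod_cast ω.toFun_mul_le r s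
              calc ‖g s‖ * (ω (r * s) : ℝ) ≤ ‖g s‖ * (ω r * ω s) :=
                    mul_le_mul_of_nonneg_left this (norm_nonneg _)
                _ = _ := by ring
          _ = (‖f r‖ * (ω r : ℝ)) * ‖g‖ := by
              rw [integral_const_mul, WeightedCc.norm_def]; ring
    _ = C * ‖f‖ * ‖g‖ := by
        rw [integral_mul_const, WeightedCc.norm_def f]; ring

/-- Twisted convolution as a bilinear map on `C_c(G, A)`. -/
def convₗ (hα : α.UniformlyBounded) : WeightedCc A μ ω →ₗ[𝕜] WeightedCc A μ ω →ₗ[𝕜] WeightedCc A μ ω :=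
  LinearMap.mk₂ 𝕜 (α.conv μ ω hα)
    (fun f₁ f₂ g => DFunLike.ext _ _ fun s => by
      have e : ∀ r, (f₁ + f₂) r = f₁ r + f₂ r := fun _ => rfl
      change ∫ r, (f₁ + f₂) r * α.act r (g (r⁻¹ * s)) ∂μ =
        (∫ r, f₁ r * α.act r (g (r⁻¹ * s)) ∂μ) + ∫ r, f₂ r * α.act r (g (r⁻¹ * s)) ∂μ
      rw [← integral_add
        (α.integrable_twist μ hα f₁.continuous f₁.hasCompactSupport g.continuous s)
        (α.integrable_twist μ hα f₂.continuous f₂.hasCompactSupport g.continuous s)]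
      simp only [e, add_mul])
    (fun c f g => DFunLike.ext _ _ fun s => by
      have e : ∀ r, (c • f) r = c • f r := fun _ => rfl
      change ∫ r, (c • f) r * α.act r (g (r⁻¹ * s)) ∂μ =
        c • ∫ r, f r * α.act r (g (r⁻¹ * s)) ∂μ
      rw [← integral_smul]
      simp only [e, smul_mul_assoc])
    (fun f g₁ g₂ => DFunLike.ext _ _ fun s => by
      have e : ∀ r, (g₁ + g₂) r = g₁ r + g₂ r := fun _ => rfl
      change ∫ r, f r * α.act r ((g₁ + g₂) (r⁻¹ * s)) ∂μ =
        (∫ r, f r * α.act r (g₁ (r⁻¹ * s)) ∂μ) + ∫ r, f r * α.act r (g₂ (r⁻¹ * s)) ∂μ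
      rw [← integral_add
        (α.integrable_twist μ hα f.continuous f.hasCompactSupport g₁.continuous s)
        (α.integrable_twist μ hα f.continuous f.hasCompactSupport g₂.continuous s)]
      simp only [e, map_add, mul_add])
    (fun c f g => DFunLike.ext _ _ fun s => by
      have e : ∀ r, (c • g) r = c • g r := fun _ => rfl
      change ∫ r, f r * α.act r ((c • g) (r⁻¹ * s)) ∂μ =
        c • ∫ r, f r * α.act r (g (r⁻¹ * s)) ∂μ
      rw [← integral_smul]
      simp only [e, map_smul, mul_smul_comm])

/-- Twisted convolution as a bounded bilinear map on the normed space `C_c(G, A)`. -/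
def convL (hα : α.UniformlyBounded) : WeightedCc A μ ω →L[𝕜] WeightedCc A μ ω →L[𝕜] WeightedCc A μ ω :=
  (α.convₗ μ ω hα).mkContinuous₂ hα.choose (α.norm_conv_le μ ω hα hα.choose_spec)

/-- The multiplication of the generalized Beurling algebra `L¹(G, A, ω; α)`: the extension by
continuity, in both variables, of twisted convolution on `C_c(G, A)`. -/
def beurlingMul (hα : α.UniformlyBounded) : BeurlingSpace A μ ω →L[𝕜] BeurlingSpace A μ ω →L[𝕜] BeurlingSpace A μ ω :=
  ((((ContinuousLinearMap.compL 𝕜 _ _ _ (ofCc μ ω 𝕜)).comp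
    (α.convL μ ω hα)).extend (ofCc μ ω 𝕜)).flip.extend (ofCc μ ω 𝕜)).flip

/-- The multiplication of `L¹(G, A, ω; α)` restricts to twisted convolution on `C_c(G, A)`. -/
theorem beurlingMul_ofCc (hα : α.UniformlyBounded) (f g : WeightedCc A μ ω) :
    α.beurlingMul μ ω hα (ofCc μ ω 𝕜 f) (ofCc μ ω 𝕜 g) = ofCc μ ω 𝕜 (α.conv μ ω hα f g) := by
  have hd : DenseRange (ofCc μ ω 𝕜 : WeightedCc A μ ω →L[𝕜] BeurlingSpace A μ ω) :=
    UniformSpace.Completion.denseRange_coe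
  have hu : IsUniformInducing (ofCc μ ω 𝕜 : WeightedCc A μ ω →L[𝕜] BeurlingSpace A μ ω) :=
    UniformSpace.Completion.isUniformInducing_coe _
  rw [beurlingMul, ContinuousLinearMap.flip_apply, ContinuousLinearMap.extend_eq _ hd hu,
    ContinuousLinearMap.flip_apply, ContinuousLinearMap.extend_eq _ hd hu]
  rfl

end DynamicalSystem

end Algebra

end Beurling

/-! ### Representations -/

section Representations

variable {𝕜 G A X : Type*} [RCLike 𝕜] [Group G] [TopologicalSpace G]
  [NonUnitalNormedRing A] [NormedSpace 𝕜 A] [NormedAddCommGroup X] [NormedSpace 𝕜 X]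

/-- A linear map `S : E → B(X)` is non-degenerate: the span of `S(E)X` is dense in `X`. -/
def IsNondegenerate {E : Type*} [SeminormedAddCommGroup E] [NormedSpace 𝕜 E]
    (S : E →L[𝕜] X →L[𝕜] X) : Prop :=
  Dense (Submodule.span 𝕜 {y : X | ∃ (e : E) (x : X), S e x = y} : Set X)

/-- `(π, U)` is a non-degenerate continuous covariant representation of `(A, G, α)` on `X`.
(Boundedness and linearity of `π` are in its type; `U r⁻¹` is the inverse of `U r`.) -/
structure IsCovariantRep (α : DynamicalSystem 𝕜 G A) (π : A →L[𝕜] X →L[𝕜] X)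
    (U : G → X →L[𝕜] X) : Prop where
  map_mul : ∀ a b : A, π (a * b) = π a * π b
  nondegenerate : IsNondegenerate π
  group_one : U 1 = 1
  group_mul : ∀ r s : G, U (r * s) = U r * U s
  continuous : ∀ x : X, Continuous fun r => U r x
  covariant : ∀ (a : A) (r : G), U r * π a * U r⁻¹ = π (α.act r a)

/-- `(π, U)` is a non-degenerate continuous pair of type `(a, a)` for `(A, G, α)` on `X`: `π` is a
non-degenerate bounded anti-representation, `U` is a strongly continuous anti-representation, and
`U_r π(a) U_r⁻¹ = π(α_{r⁻¹}(a))`. -/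
structure IsAntiCovariantPair (α : DynamicalSystem 𝕜 G A) (π : A →L[𝕜] X →L[𝕜] X)
    (U : G → X →L[𝕜] X) : Prop where
  map_mul : ∀ a b : A, π (a * b) = π b * π a
  nondegenerate : IsNondegenerate π
  group_one : U 1 = 1
  group_mul : ∀ r s : G, U (r * s) = U s * U r
  continuous : ∀ x : X, Continuous fun r => U r x
  anticovariant : ∀ (a : A) (r : G), U r * π a * U r⁻¹ = π (α.act r⁻¹ a)

/-- `‖U_r‖ ≤ C ω(r)` for some constant `C` and all `r`. -/
def WeightBounded [MeasurableSpace G] (U : G → X →L[𝕜] X) (ω : Weight G) : Prop :=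
  ∃ C : ℝ, ∀ r : G, ‖U r‖ ≤ C * ω r

/-- Two `B(X)`-valued maps commute. -/
def MapsCommute {S₁ S₂ : Type*} (φ₁ : S₁ → X →L[𝕜] X) (φ₂ : S₂ → X →L[𝕜] X) : Prop :=
  ∀ s₁ s₂, φ₁ s₁ * φ₂ s₂ = φ₂ s₂ * φ₁ s₁

/-- The pairs `(π₁, U₁)` and `(π₂, U₂)` commute: each of `π₁`, `U₁` commutes with each of
`π₂`, `U₂`. -/
def PairsCommute {A₁ G₁ A₂ G₂ : Type*} (π₁ : A₁ → X →L[𝕜] X) (U₁ : G₁ → X →L[𝕜] X)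
    (π₂ : A₂ → X →L[𝕜] X) (U₂ : G₂ → X →L[𝕜] X) : Prop :=
  MapsCommute π₁ π₂ ∧ MapsCommute π₁ U₂ ∧ MapsCommute U₁ π₂ ∧ MapsCommute U₁ U₂

end Representations

section BeurlingRepresentations

variable {𝕜 G A X : Type*} [RCLike 𝕜]
  [Group G] [TopologicalSpace G] [IsTopologicalGroup G] [LocallyCompactSpace G] [T2Space G]
  [MeasurableSpace G] [BorelSpace G]
  [NonUnitalNormedRing A] [NormedSpace ℝ A] [NormedSpace 𝕜 A] [IsScalarTower ℝ 𝕜 A]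
  [IsScalarTower 𝕜 A A] [SMulCommClass 𝕜 A A] [CompleteSpace A]
  [NormedAddCommGroup X] [NormedSpace 𝕜 X]
  {μ : Measure G} [μ.IsHaarMeasure] [μ.Regular] {ω : Weight G}

/-- `T` is a non-degenerate bounded representation of `L¹(G, A, ω; α)` on `X`. -/
structure IsBeurlingRep (α : DynamicalSystem 𝕜 G A) (hα : α.UniformlyBounded)
    (T : BeurlingSpace A μ ω →L[𝕜] X →L[𝕜] X) : Prop where
  map_mul : ∀ u v : BeurlingSpace A μ ω, T (α.beurlingMul μ ω hα u v) = T u * T v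
  nondegenerate : IsNondegenerate T

/-- `T` is a non-degenerate bounded anti-representation of `L¹(G, A, ω; α)` on `X`. -/
structure IsBeurlingAntiRep (α : DynamicalSystem 𝕜 G A) (hα : α.UniformlyBounded)
    (T : BeurlingSpace A μ ω →L[𝕜] X →L[𝕜] X) : Prop where
  map_mul : ∀ u v : BeurlingSpace A μ ω, T (α.beurlingMul μ ω hα u v) = T v * T u
  nondegenerate : IsNondegenerate T

variable [NormedSpace ℝ X]

/-- `T(f) = ∫ π(f(r)) U_r dμ(r)` for `f ∈ C_c(G, A)`, as a strong operator integral. -/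
def IsIntegratedForm (π : A →L[𝕜] X →L[𝕜] X) (U : G → X →L[𝕜] X)
    (T : BeurlingSpace A μ ω →L[𝕜] X →L[𝕜] X) : Prop :=
  ∀ (f : WeightedCc A μ ω) (x : X), T (ofCc μ ω 𝕜 f) x = ∫ r, π (f r) (U r x) ∂μ

/-- `T(f) = ∫ U_r π(f(r)) dμ(r)` for `f ∈ C_c(G, A)`, as a strong operator integral. -/
def IsAntiIntegratedForm (π : A →L[𝕜] X →L[𝕜] X) (U : G → X →L[𝕜] X)
    (T : BeurlingSpace A μ ω →L[𝕜] X →L[𝕜] X) : Prop :=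
  ∀ (f : WeightedCc A μ ω) (x : X), T (ofCc μ ω 𝕜 f) x = ∫ r, U r (π (f r) x) ∂μ

end BeurlingRepresentations

end BeurlingBimodule

end

/-!
Pointwise left multiplication by `a ∈ A` and the translations `f ↦ (s ↦ α_r(f(r⁻¹s)))` are left
centralizers of `C_c(G, A)` under twisted convolution. If `φ` runs through probability densities
whose supports shrink to the identity and `u` through a bounded left approximate identity of `A`,
the elementary tensors `φ ⊗ u` are a bounded left approximate identity of `L¹(G, A, ω; α)`. A
non-degenerate bounded representation `T` therefore extends to these centralizers by strong limits,
which gives `π` and `U` with `π(a) T(f) = T(a f)` and `U_r T(f) = T(α_r ∘ f(r⁻¹ ·))`. By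
non-degeneracy these relations determine `(π, U)`, and an operator commuting with `T` commutes with
`π` and `U`. As `f * g` is the integral over `r` of the translates of `g` by `r`, multiplied by
`f(r)`, applying `T` shows that `T` is the integrated form of `(π, U)`; read in the other direction,
the same formula makes integrated forms multiplicative.

With `Δ` the modular function, `f ↦ (s ↦ Δ(s) α_s(f(s⁻¹)))` reverses products and identifies
`L¹(G, A, ω; α)` with `L¹(G, Aᵒᵖ, ω(·⁻¹); α)`. It turns anti-representations into representations
and `(π, U)` into the covariant pair `(π, r ↦ U_{r⁻¹})` of `(Aᵒᵖ, G, α)`.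
-/

noncomputable section

namespace BeurlingBimodule

open scoped Pointwise BoundedContinuousFunction

/-! ### Strong limits of bounded nets of operators -/

section StrongLimits

variable {𝕜 E F ι : Type*} [NontriviallyNormedField 𝕜]
  [NormedAddCommGroup E] [NormedSpace 𝕜 E] [NormedAddCommGroup F] [NormedSpace 𝕜 F]
  {l : Filter ι} {S : ι → E →L[𝕜] F} {M : ℝ}

theorem tendsto_clm_apply_of_bounded (hM : ∀ᶠ i in l, ‖S i‖ ≤ M) {v : ι → E} {x : E} {y : F}
    (hS : Tendsto (fun i => S i x) l (𝓝 y)) (hv : Tendsto v l (𝓝 x)) :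
    Tendsto (fun i => S i (v i)) l (𝓝 y) := by
  have hdiff : Tendsto (fun i => S i (v i - x)) l (𝓝 0) :=
    (tendsto_sub_nhds_zero_iff.2 hv).op_zero_isBoundedUnder_le ⟨M, eventually_map.2 hM⟩
      (fun w L => L w) fun w L => by rw [mul_comm]; exact L.le_opNorm w
  simpa using hdiff.add hS

theorem tendsto_clm_apply_of_dense_span (hM : ∀ᶠ i in l, ‖S i‖ ≤ M) (S₀ : E →L[𝕜] F) {D : Set E}
    (hD : Dense (Submodule.span 𝕜 D : Set E))
    (h : ∀ y ∈ D, Tendsto (fun i => S i y) l (𝓝 (S₀ y))) (x : E) :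
    Tendsto (fun i => S i x) l (𝓝 (S₀ x)) := by
  have hspan : ∀ y ∈ Submodule.span 𝕜 D, Tendsto (fun i => S i y) l (𝓝 (S₀ y)) := fun y hy => by
    induction hy using Submodule.span_induction with
    | mem y hy => exact h y hy
    | zero => simpa using tendsto_const_nhds
    | add y z _ _ hy hz => simpa using hy.add hz
    | smul c y _ hy => simpa using hy.const_smul c
  rw [Metric.tendsto_nhds]
  intro ε hε
  obtain ⟨δ, hδ, hMδ⟩ : ∃ δ > 0, (|M| + ‖S₀‖) * δ < ε / 2 :=
    exists_pos_mul_lt (half_pos hε) _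
  obtain ⟨y, hy, hxy⟩ := Metric.mem_closure_iff.1 (hD x) δ hδ
  filter_upwards [hM, Metric.tendsto_nhds.1 (hspan y hy) (ε / 2) (half_pos hε)] with i hi hiy
  have hnear : ‖(S i - S₀) (x - y)‖ < ε / 2 := by
    refine lt_of_le_of_lt ?_ hMδ
    refine ((S i - S₀).le_of_opNorm_le_of_le ?_ (dist_eq_norm x y ▸ hxy.le))
    exact (norm_sub_le _ _).trans (by gcongr; exact hi.trans (le_abs_self M))
  rw [dist_eq_norm] at hiy ⊢
  calc ‖S i x - S₀ x‖ = ‖(S i - S₀) (x - y) + (S i y - S₀ y)‖ := by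
        simp only [map_sub, sub_apply]; abel_nf
    _ ≤ ‖(S i - S₀) (x - y)‖ + ‖S i y - S₀ y‖ := norm_add_le _ _
    _ < ε := by linarith

theorem exists_tendsto_clm_apply_of_dense_span [CompleteSpace F] [l.NeBot]
    (hM : ∀ᶠ i in l, ‖S i‖ ≤ M) {D : Set E} (hD : Dense (Submodule.span 𝕜 D : Set E))
    (h : ∀ y ∈ D, ∃ z, Tendsto (fun i => S i y) l (𝓝 z)) :
    ∃ S₀ : E →L[𝕜] F, ‖S₀‖ ≤ M ∧ ∀ x, Tendsto (fun i => S i x) l (𝓝 (S₀ x)) := by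
  have hbound : ∀ᶠ p : ι × ι in l ×ˢ l, ‖S p.2 - S p.1‖ ≤ M + M := by
    filter_upwards [hM.prod_mk hM] with p hp
    exact (norm_sub_le _ _).trans (add_le_add hp.2 hp.1)
  have hcauchy : ∀ x, Cauchy (map (fun i => S i x) l) := fun x => by
    rw [cauchy_map_iff, uniformity_eq_comap_nhds_zero, tendsto_comap_iff]
    refine ⟨inferInstance, tendsto_clm_apply_of_dense_span hbound 0 hD (fun y hy => ?_) x⟩
    obtain ⟨z, hz⟩ := h y hy
    simpa using (hz.comp tendsto_snd).sub (hz.comp tendsto_fst)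
  choose L hL using fun x => cauchy_map_iff_exists_tendsto.1 (hcauchy x)
  have hM0 : 0 ≤ M := let ⟨i, hi⟩ := hM.exists; (norm_nonneg _).trans hi
  refine ⟨(linearMapOfTendsto L (fun i => (S i : E →ₗ[𝕜] F)) (tendsto_pi_nhds.2 hL)).mkContinuous M
    fun x => ?_, LinearMap.mkContinuous_norm_le _ hM0 _, hL⟩
  refine le_of_tendsto (hL x).norm ?_
  filter_upwards [hM] with i hi using (S i).le_of_opNorm_le hi x

end StrongLimits

/-! ### Convergence and vector-valued integration in `C_c(G, A)` -/

section Cc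

variable {G : Type*} [Group G] [TopologicalSpace G] [MeasurableSpace G]
  {A : Type*} [NormedAddCommGroup A]

namespace WeightedCc

section Algebra

variable (μ : Measure G) (ω : Weight G)

/-- A compactly supported continuous function as an element of `WeightedCc A μ ω`. -/
def mk (f : G → A) (hf : Continuous f) (hs : HasCompactSupport f) : WeightedCc A μ ω :=
  (⟨⟨f, hf⟩, hs⟩ : C_c(G, A))

@[simp] theorem mk_apply (f : G → A) (hf : Continuous f) (hs : HasCompactSupport f) (s : G) :
    mk μ ω f hf hs s = f s := rfl

variable {μ ω}

@[ext] theorem ext {f g : WeightedCc A μ ω} (h : ∀ s, f s = g s) : f = g := DFunLike.ext _ _ h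

@[simp] theorem add_apply (f g : WeightedCc A μ ω) (s : G) : (f + g) s = f s + g s := rfl

@[simp] theorem smul_apply {𝕜 : Type*} [RCLike 𝕜] [NormedSpace 𝕜 A] (c : 𝕜) (f : WeightedCc A μ ω)
    (s : G) : (c • f) s = c • f s := rfl

end Algebra

variable {μ : Measure G} {ω : Weight G}

/-- The inclusion of `C_c(G, A)` in the bounded continuous functions with the supremum norm. -/
def toBounded (f : WeightedCc A μ ω) : G →ᵇ A :=
  CompactlySupportedContinuousMap.toBoundedContinuousFunction f

@[simp] theorem toBounded_apply (f : WeightedCc A μ ω) (s : G) : f.toBounded s = f s := rfl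

theorem tendsto_toBounded {ι : Type*} {l : Filter ι} {Φ : ι → WeightedCc A μ ω}
    {f : WeightedCc A μ ω} {K : Set G} (hK : IsCompact K) (hΦ : ∀ᶠ i in l, ∀ s ∉ K, Φ i s = 0)
    (hf : ∀ s ∉ K, f s = 0)
    (h : ∀ s ∈ K, Tendsto (fun p : ι × G => Φ p.1 p.2) (l ×ˢ 𝓝 s) (𝓝 (f s))) :
    Tendsto (fun i => (Φ i).toBounded) l (𝓝 f.toBounded) := by
  rw [BoundedContinuousFunction.tendsto_iff_tendstoUniformly]
  have hunif : TendstoUniformlyOn (fun i => Φ i) f l K := by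
    rw [← tendstoLocallyUniformlyOn_iff_tendstoUniformlyOn_of_compact hK,
      tendstoLocallyUniformlyOn_iff_forall_tendsto]
    intro s hs
    have hnhds : Tendsto (fun p : ι × G => (f p.2, Φ p.1 p.2)) (l ×ˢ 𝓝[K] s) (𝓝 (f s, f s)) :=
      (((f.toBounded.continuous.tendsto s).comp tendsto_snd).prodMk_nhds (h s hs)).mono_left
        (prod_mono le_rfl nhdsWithin_le_nhds)
    exact hnhds.mono_right (nhds_le_uniformity (f s))
  intro V hV
  filter_upwards [hunif V hV, hΦ] with i hi hi0 s
  by_cases hs : s ∈ K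
  · exact hi s hs
  · simpa [hi0 s hs, hf s hs] using refl_mem_uniformity hV

variable [IsTopologicalGroup G] [LocallyCompactSpace G] [T2Space G] [BorelSpace G]
  [μ.IsHaarMeasure] [μ.Regular]

theorem norm_le_of_forall_le {B : Type*} [NormedAddCommGroup B] (f : WeightedCc A μ ω)
    (g : WeightedCc B μ ω) (c : ℝ) (h : ∀ s, ‖f s‖ ≤ c * ‖g s‖) : ‖f‖ ≤ c * ‖g‖ := by
  rw [norm_def, norm_def, ← integral_const_mul]
  refine integral_mono f.integrable_norm_mul (g.integrable_norm_mul.const_mul c) fun s => ?_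
  rw [← mul_assoc]
  exact mul_le_mul_of_nonneg_right (h s) (ω s).coe_nonneg

variable (𝕜 : Type*) [RCLike 𝕜] [NormedSpace 𝕜 A]

/-- Multiplication by `χ ∈ C_c(G, ℝ)`, a bounded operator from bounded continuous functions in the
supremum norm to `C_c(G, A)` in the weighted norm. -/
def cutoff (χ : WeightedCc ℝ μ ω) : (G →ᵇ A) →L[𝕜] WeightedCc A μ ω :=
  LinearMap.mkContinuous
    { toFun := fun h => mk μ ω (fun s => (χ s : 𝕜) • h s)
        ((RCLike.continuous_ofReal.comp χ.continuous).smul h.continuous)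
        (χ.hasCompactSupport.mono fun s hs h0 => hs (by simp [h0]))
      map_add' := fun _ _ => ext fun _ => smul_add _ _ _
      map_smul' := fun _ _ => ext fun _ => smul_comm _ _ _ }
    ‖χ‖ fun h => by
      rw [mul_comm]
      refine norm_le_of_forall_le _ χ ‖h‖ fun s => ?_
      simpa [norm_smul, mul_comm] using
        mul_le_mul_of_nonneg_left (h.norm_coe_le_norm s) (abs_nonneg (χ s))

@[simp] theorem cutoff_apply (χ : WeightedCc ℝ μ ω) (h : G →ᵇ A) (s : G) :
    cutoff 𝕜 χ h s = (χ s : 𝕜) • h s := rfl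

variable (A μ ω) in
theorem exists_cutoff_toBounded_eq {K : Set G} (hK : IsCompact K) :
    ∃ χ : WeightedCc ℝ μ ω, ∀ f : WeightedCc A μ ω, (∀ s ∉ K, f s = 0) →
      cutoff 𝕜 χ f.toBounded = f := by
  obtain ⟨χ, hχ, -, hχs, -⟩ := exists_continuous_one_zero_of_isCompact hK isClosed_empty
    (Set.disjoint_empty K)
  refine ⟨mk μ ω χ χ.continuous hχs, fun f hf => ext fun s => ?_⟩
  by_cases hs : s ∈ K
  · simp [hχ hs]
  · simp [hf s hs]

theorem tendsto_of_compact [NormedSpace ℝ A] {ι : Type*} {l : Filter ι} {Φ : ι → WeightedCc A μ ω}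
    {f : WeightedCc A μ ω} {K : Set G} (hK : IsCompact K) (hΦ : ∀ᶠ i in l, ∀ s ∉ K, Φ i s = 0)
    (hf : ∀ s ∉ K, f s = 0)
    (h : ∀ s ∈ K, Tendsto (fun p : ι × G => Φ p.1 p.2) (l ×ˢ 𝓝 s) (𝓝 (f s))) :
    Tendsto Φ l (𝓝 f) := by
  obtain ⟨χ, hχ⟩ := exists_cutoff_toBounded_eq A μ ω ℝ hK
  have hlim := ((cutoff ℝ χ).continuous.tendsto _).comp (tendsto_toBounded hK hΦ hf h)
  rw [hχ f hf] at hlim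
  exact hlim.congr' (hΦ.mono fun i hi => hχ (Φ i) hi)

variable {𝕜} in
/-- The integral of `Φ` exists in the Banach space of bounded continuous functions, where point
evaluations identify it with `f`; a cutoff brings it back to `C_c(G, A)`, which is not complete. -/
theorem map_eq_integral [NormedSpace ℝ A] [CompleteSpace A] {F Y : Type*} [NormedAddCommGroup F]
    [NormedSpace ℝ F] [NormedSpace 𝕜 F] [CompleteSpace F] (T : WeightedCc A μ ω →L[𝕜] F)
    [TopologicalSpace Y] [MeasurableSpace Y] [OpensMeasurableSpace Y] {ν : Measure Y}
    [IsFiniteMeasureOnCompacts ν] {Φ : Y → WeightedCc A μ ω} {f : WeightedCc A μ ω} {K : Set G}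
    (hΦ : Continuous fun p : Y × G => Φ p.1 p.2) (hΦc : HasCompactSupport Φ) (hK : IsCompact K)
    (hΦK : ∀ y, ∀ s ∉ K, Φ y s = 0) (hf : ∀ s, f s = ∫ y, Φ y s ∂ν) :
    T f = ∫ y, T (Φ y) ∂ν := by
  obtain ⟨χ, hχ⟩ := exists_cutoff_toBounded_eq A μ ω 𝕜 hK
  have hcont : Continuous fun y => (Φ y).toBounded :=
    continuous_iff_continuousAt.2 fun y =>
      tendsto_toBounded hK (.of_forall hΦK) (hΦK y) fun s _ => by
        rw [← nhds_prod_eq]; exact hΦ.tendsto (y, s)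
  have hint : Integrable (fun y => (Φ y).toBounded) ν :=
    hcont.integrable_of_hasCompactSupport (hΦc.comp_left rfl)
  have hbounded : ∫ y, (Φ y).toBounded ∂ν = f.toBounded := by
    ext s
    rw [← BoundedContinuousFunction.evalCLM_apply ℝ,
      ← ContinuousLinearMap.integral_comp_comm _ hint]
    exact (hf s).symm
  have hfK : ∀ s ∉ K, f s = 0 := fun s hs => by simp [hf s, hΦK _ s hs]
  have hcomm := (T.comp (cutoff 𝕜 χ)).integral_comp_comm hint
  simpa only [hbounded, ContinuousLinearMap.comp_apply, hχ f hfK, hχ _ (hΦK _)] using hcomm.symm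

end WeightedCc

end Cc

/-! ### Mollification -/

section Mollification

variable {G : Type*} [TopologicalSpace G] [MeasurableSpace G]

/-- A continuous compactly supported probability density with respect to `μ`. -/
structure Bump (μ : Measure G) where
  toFun : G → ℝ
  continuous : Continuous toFun
  hasCompactSupport : HasCompactSupport toFun
  nonneg : ∀ s, 0 ≤ toFun s
  integral_eq_one : ∫ s, toFun s ∂μ = 1

namespace Bump

variable {μ : Measure G}

instance : CoeFun (Bump μ) fun _ => G → ℝ := ⟨toFun⟩

section Integral

variable [BorelSpace G] [IsFiniteMeasureOnCompacts μ]

theorem integrable (φ : Bump μ) : Integrable φ μ :=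
  φ.continuous.integrable_of_hasCompactSupport φ.hasCompactSupport

variable {𝕜 E : Type*} [RCLike 𝕜] [NormedAddCommGroup E] [NormedSpace 𝕜 E]

theorem integrable_smul (φ : Bump μ) {F : G → E} (hF : Continuous F) :
    Integrable (fun r => (φ r : 𝕜) • F r) μ :=
  ((RCLike.continuous_ofReal.comp φ.continuous).smul hF).integrable_of_hasCompactSupport
    (φ.hasCompactSupport.mono fun r hr h => hr (by simp [h]))

theorem norm_integral_smul_sub_le [NormedSpace ℝ E] [CompleteSpace E] (φ : Bump μ) {F : G → E}
    (hF : Continuous F) {v : E} {ε : ℝ} (h : ∀ r ∈ Function.support φ, ‖F r - v‖ ≤ ε) :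
    ‖∫ r, (φ r : 𝕜) • F r ∂μ - v‖ ≤ ε := by
  have hv : ∫ r, (φ r : 𝕜) • v ∂μ = v := by
    rw [integral_smul_const, integral_ofReal, φ.integral_eq_one, RCLike.ofReal_one, one_smul]
  calc ‖∫ r, (φ r : 𝕜) • F r ∂μ - v‖ = ‖∫ r, (φ r : 𝕜) • (F r - v) ∂μ‖ := by
        simp only [smul_sub]
        rw [integral_sub (φ.integrable_smul hF) (φ.integrable_smul continuous_const), hv]
    _ ≤ ∫ r, φ r * ε ∂μ := by
        refine norm_integral_le_of_norm_le (φ.integrable.mul_const ε) (.of_forall fun r => ?_)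
        rw [norm_smul, RCLike.norm_ofReal, abs_of_nonneg (φ.nonneg r)]
        by_cases hr : φ r = 0
        · simp [hr]
        · exact mul_le_mul_of_nonneg_left (h r hr) (φ.nonneg r)
    _ = ε := by rw [integral_mul_const, φ.integral_eq_one, one_mul]

end Integral

variable [Group G]

/-- `φ` as an element of the weighted space `C_c(G, ℝ)`. -/
def toWeightedCc (φ : Bump μ) (ω : Weight G) : WeightedCc ℝ μ ω :=
  .mk μ ω φ φ.continuous φ.hasCompactSupport

@[simp] theorem toWeightedCc_apply (φ : Bump μ) (ω : Weight G) (s : G) :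
    φ.toWeightedCc ω s = φ s := rfl

/-- The filter on bump functions along which the supports shrink to the identity. -/
def shrinking (μ : Measure G) : Filter (Bump μ) :=
  comap (fun φ => Function.support φ) (𝓝 (1 : G)).smallSets

theorem eventually_support_subset {V : Set G} (hV : V ∈ 𝓝 (1 : G)) :
    ∀ᶠ φ : Bump μ in shrinking μ, Function.support φ ⊆ V :=
  tendsto_comap.eventually (eventually_smallSets_subset.2 hV)

section Limit

variable [BorelSpace G] [IsFiniteMeasureOnCompacts μ]
  {𝕜 E : Type*} [RCLike 𝕜] [NormedAddCommGroup E] [NormedSpace ℝ E] [NormedSpace 𝕜 E]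
  [CompleteSpace E]

theorem tendsto_integral_smul {ι : Type*} {l : Filter ι} {F : ι → G → E} {v : E}
    (hF : ∀ i, Continuous (F i)) (h : Tendsto F.uncurry (l ×ˢ 𝓝 1) (𝓝 v)) :
    Tendsto (fun p : ι × Bump μ => ∫ r, (p.2 r : 𝕜) • F p.1 r ∂μ) (l ×ˢ shrinking μ) (𝓝 v) := by
  rw [Metric.tendsto_nhds]
  intro ε hε
  obtain ⟨p, hp, q, hq, hpq⟩ :=
    eventually_prod_iff.1 (h.eventually (Metric.closedBall_mem_nhds v (half_pos hε)))
  filter_upwards [hp.prod_mk (eventually_support_subset hq)] with x hx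
  rw [dist_eq_norm]
  refine (x.2.norm_integral_smul_sub_le (hF x.1) fun r hr => ?_).trans_lt (half_lt_self hε)
  simpa [dist_eq_norm] using hpq hx.1 (hx.2 hr)

theorem tendsto_integral_smul_of_continuous {F : G → E} (hF : Continuous F) :
    Tendsto (fun φ : Bump μ => ∫ r, (φ r : 𝕜) • F r ∂μ) (shrinking μ) (𝓝 (F 1)) :=
  (tendsto_integral_smul (l := pure ()) (F := fun _ => F) (fun _ => hF)
    ((hF.tendsto 1).comp tendsto_snd)).comp (tendsto_const_pure.prodMk tendsto_id)

end Limit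

variable [IsTopologicalGroup G] [LocallyCompactSpace G] [BorelSpace G] [μ.IsHaarMeasure]

theorem exists_support_subset {V : Set G} (hV : V ∈ 𝓝 (1 : G)) :
    ∃ φ : Bump μ, Function.support φ ⊆ V := by
  obtain ⟨φ, h1, h0, hs, hI⟩ := exists_continuous_one_zero_of_isCompact
    (isCompact_singleton (x := (1 : G))) (isOpen_interior (s := V)).isClosed_compl
    (Set.disjoint_singleton_left.2 fun h => h (mem_interior_iff_mem_nhds.2 hV))
  have hpos : 0 < ∫ s, φ s ∂μ :=
    φ.continuous.integral_pos_of_hasCompactSupport_nonneg_nonzero hs (fun s => (hI s).1)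
      (x := 1) (by simp [h1 (Set.mem_singleton _)])
  refine ⟨⟨fun s => (∫ s, φ s ∂μ)⁻¹ * φ s, φ.continuous.const_mul _, hs.mul_left,
    fun s => mul_nonneg (inv_nonneg.2 hpos.le) (hI s).1, ?_⟩, fun s hsφ => ?_⟩
  · rw [integral_const_mul, inv_mul_cancel₀ hpos.ne']
  · exact interior_subset (not_not.1 fun hsV => (right_ne_zero_of_mul hsφ) (h0 hsV))

instance neBot_shrinking : (shrinking μ).NeBot :=
  comap_neBot_iff.2 fun t ht => by
    obtain ⟨V, hV, hVt⟩ := eventually_smallSets.1 ht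
    obtain ⟨φ, hφ⟩ := exists_support_subset (μ := μ) hV
    exact ⟨φ, hVt _ hφ⟩

variable [T2Space G] [μ.Regular]

theorem norm_toWeightedCc_le (φ : Bump μ) {ω : Weight G} {C : ℝ}
    (hC : ∀ r ∈ Function.support φ, (ω r : ℝ) ≤ C) : ‖φ.toWeightedCc ω‖ ≤ C := by
  have hle : ∀ r, ‖φ.toWeightedCc ω r‖ * (ω r : ℝ) ≤ φ r * C := fun r => by
    rw [toWeightedCc_apply, Real.norm_of_nonneg (φ.nonneg r)]
    by_cases hr : φ r = 0
    · simp [hr]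
    · exact mul_le_mul_of_nonneg_left (hC r hr) (φ.nonneg r)
  calc ‖φ.toWeightedCc ω‖ ≤ ∫ r, φ r * C ∂μ :=
        integral_mono (φ.toWeightedCc ω).integrable_norm_mul (φ.integrable.mul_const C) hle
    _ = C := by rw [integral_mul_const, φ.integral_eq_one, one_mul]

end Bump

end Mollification

/-! ### Left centralizers of `C_c(G, A)` -/

section Centralizers

variable {𝕜 G A : Type*} [RCLike 𝕜]
  [Group G] [TopologicalSpace G] [IsTopologicalGroup G] [LocallyCompactSpace G] [T2Space G]
  [MeasurableSpace G] [BorelSpace G] [NonUnitalNormedRing A] [NormedSpace 𝕜 A]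
  (μ : Measure G) [μ.IsHaarMeasure] [μ.Regular] (ω : Weight G)

section LeftMul

variable [IsScalarTower 𝕜 A A] [SMulCommClass 𝕜 A A]

variable (𝕜) in
/-- The action of `A` on `C_c(G, A)` by pointwise multiplication on the left. -/
def leftMul : A →L[𝕜] WeightedCc A μ ω →L[𝕜] WeightedCc A μ ω :=
  (LinearMap.mk₂ 𝕜
    (fun a f => .mk μ ω (fun s => a * f s) (continuous_const.mul f.continuous)
      f.hasCompactSupport.mul_left)
    (fun _ _ _ => WeightedCc.ext fun _ => add_mul _ _ _)
    (fun _ _ _ => WeightedCc.ext fun _ => smul_mul_assoc _ _ _)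
    (fun _ _ _ => WeightedCc.ext fun _ => mul_add _ _ _)
    (fun _ _ _ => WeightedCc.ext fun _ => mul_smul_comm _ _ _)).mkContinuous₂ 1 fun a f => by
      rw [one_mul]
      exact WeightedCc.norm_le_of_forall_le _ f ‖a‖ fun s => norm_mul_le a (f s)

@[simp] theorem leftMul_apply (a : A) (f : WeightedCc A μ ω) (s : G) :
    leftMul 𝕜 μ ω a f s = a * f s := rfl

theorem norm_leftMul_le (a : A) : ‖leftMul 𝕜 μ ω a‖ ≤ ‖a‖ :=
  ContinuousLinearMap.opNorm_le_bound _ (norm_nonneg a) fun f =>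
    WeightedCc.norm_le_of_forall_le _ f ‖a‖ fun s => norm_mul_le a (f s)

theorem leftMul_mul (a b : A) (f : WeightedCc A μ ω) :
    leftMul 𝕜 μ ω (a * b) f = leftMul 𝕜 μ ω a (leftMul 𝕜 μ ω b f) :=
  WeightedCc.ext fun s => mul_assoc a b (f s)

end LeftMul

namespace DynamicalSystem

variable (α : DynamicalSystem 𝕜 G A)

/-- The action of `G` on `C_c(G, A)` by `f ↦ (s ↦ α_r(f(r⁻¹ s)))`. -/
def translate (r : G) : WeightedCc A μ ω →L[𝕜] WeightedCc A μ ω :=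
  LinearMap.mkContinuous
    { toFun := fun f => .mk μ ω (fun s => α.act r (f (r⁻¹ * s)))
        ((α.act r).continuous.comp (f.continuous.comp (continuous_const_mul r⁻¹)))
        ((f.hasCompactSupport.comp_homeomorph (Homeomorph.mulLeft r⁻¹)).comp_left
          (g := α.act r) (map_zero _))
      map_add' := fun _ _ => WeightedCc.ext fun _ => map_add (α.act r) _ _
      map_smul' := fun _ _ => WeightedCc.ext fun _ => map_smul (α.act r) _ _ }
    (‖α.act r‖ * ω r) fun f => by
      rw [WeightedCc.norm_def, WeightedCc.norm_def, ← integral_const_mul,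
        ← integral_mul_left_eq_self _ r]
      refine integral_mono_of_nonneg
        (.of_forall fun s => mul_nonneg (norm_nonneg _) (ω _).coe_nonneg)
        (f.integrable_norm_mul.const_mul _) (.of_forall fun s => ?_)
      have hω : (ω (r * s) : ℝ) ≤ ω r * ω s := by exact_mod_cast ω.toFun_mul_le r s
      calc ‖α.act r (f (r⁻¹ * (r * s)))‖ * (ω (r * s) : ℝ)
          ≤ (‖α.act r‖ * ‖f s‖) * (ω r * ω s) := by
            rw [inv_mul_cancel_left]
            gcongr
            exact (α.act r).le_opNorm (f s)
        _ = ‖α.act r‖ * ω r * (‖f s‖ * ω s) := by ring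

@[simp] theorem translate_apply (r : G) (f : WeightedCc A μ ω) (s : G) :
    α.translate μ ω r f s = α.act r (f (r⁻¹ * s)) := rfl

theorem norm_translate_le (r : G) : ‖α.translate μ ω r‖ ≤ ‖α.act r‖ * ω r :=
  LinearMap.mkContinuous_norm_le _ (mul_nonneg (norm_nonneg _) (ω r).coe_nonneg) _

theorem translate_one (f : WeightedCc A μ ω) : α.translate μ ω 1 f = f :=
  WeightedCc.ext fun s => by simp

theorem translate_mul (r t : G) (f : WeightedCc A μ ω) :
    α.translate μ ω (r * t) f = α.translate μ ω r (α.translate μ ω t f) :=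
  WeightedCc.ext fun s => by simp [mul_assoc]

theorem translate_leftMul [IsScalarTower 𝕜 A A] [SMulCommClass 𝕜 A A] (r : G) (a : A)
    (f : WeightedCc A μ ω) :
    α.translate μ ω r (leftMul 𝕜 μ ω a f) = leftMul 𝕜 μ ω (α.act r a) (α.translate μ ω r f) :=
  WeightedCc.ext fun s => by simp [α.act_mul]

section Convolution

variable [NormedSpace ℝ A]

theorem continuous_translate_apply (hα : α.UniformlyBounded) (f : WeightedCc A μ ω) :
    Continuous fun r => α.translate μ ω r f := by
  rw [continuous_iff_continuousAt]
  intro r₀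
  obtain ⟨N, hN, hNr⟩ := exists_compact_mem_nhds r₀
  have hzero : ∀ r ∈ N, ∀ s ∉ N * tsupport f, α.translate μ ω r f s = 0 := fun r hr s hs => by
    have hrs : r⁻¹ * s ∉ tsupport f := fun h => hs (Set.mem_mul.2 ⟨r, hr, _, h, by group⟩)
    rw [translate_apply, image_eq_zero_of_notMem_tsupport hrs, map_zero]
  have hcont : Continuous fun p : G × G => α.act p.1 (f (p.1⁻¹ * p.2)) :=
    (α.continuous_uncurry hα).comp (continuous_fst.prodMk
      (f.continuous.comp (continuous_fst.inv.mul continuous_snd)))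
  refine WeightedCc.tendsto_of_compact (hN.mul f.hasCompactSupport.isCompact)
    (eventually_of_mem hNr hzero) (hzero r₀ (mem_of_mem_nhds hNr)) fun s _ => ?_
  rw [← nhds_prod_eq]
  exact hcont.tendsto (r₀, s)

variable [IsScalarTower ℝ 𝕜 A] [IsScalarTower 𝕜 A A] [SMulCommClass 𝕜 A A] [CompleteSpace A]
  (hα : α.UniformlyBounded)

theorem leftMul_conv (a : A) (f g : WeightedCc A μ ω) :
    leftMul 𝕜 μ ω a (α.conv μ ω hα f g) = α.conv μ ω hα (leftMul 𝕜 μ ω a f) g := by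
  ext s
  have hint := α.integrable_twist μ hα f.continuous f.hasCompactSupport g.continuous s
  calc a * ∫ r, f r * α.act r (g (r⁻¹ * s)) ∂μ
      = ∫ r, a * (f r * α.act r (g (r⁻¹ * s))) ∂μ :=
        ((ContinuousLinearMap.mul 𝕜 A a).integral_comp_comm hint).symm
    _ = α.conv μ ω hα (leftMul 𝕜 μ ω a f) g s := by simp only [conv_apply, leftMul_apply, mul_assoc]

theorem translate_conv (t : G) (f g : WeightedCc A μ ω) :
    α.translate μ ω t (α.conv μ ω hα f g) = α.conv μ ω hα (α.translate μ ω t f) g := by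
  ext s
  have hint := α.integrable_twist μ hα f.continuous f.hasCompactSupport g.continuous (t⁻¹ * s)
  rw [translate_apply, conv_apply, conv_apply, ← (α.act t).integral_comp_comm hint,
    ← integral_mul_left_eq_self (fun r => α.translate μ ω t f r * α.act r (g (r⁻¹ * s))) t]
  simp [α.act_mul, mul_assoc]

theorem map_conv_eq_integral {F : Type*} [NormedAddCommGroup F] [NormedSpace ℝ F]
    [NormedSpace 𝕜 F] [CompleteSpace F] (T : WeightedCc A μ ω →L[𝕜] F)
    (f g : WeightedCc A μ ω) :
    T (α.conv μ ω hα f g) = ∫ r, T (leftMul 𝕜 μ ω (f r) (α.translate μ ω r g)) ∂μ :=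
  WeightedCc.map_eq_integral T (K := tsupport f * tsupport g)
    ((α.continuous_twist hα f.continuous g.continuous).comp continuous_swap)
    (f.hasCompactSupport.mono fun r hr h => hr (by simp [h]))
    (f.hasCompactSupport.isCompact.mul g.hasCompactSupport.isCompact)
    (fun r s hs => α.twist_eq_zero fun h => hs (Set.mem_mul.2 ⟨r, h.1, _, h.2, by group⟩))
    fun _ => rfl

end Convolution

end DynamicalSystem

end Centralizers

/-! ### Bounded approximate identities -/

section ApproxIdentity

/-- `E` has a bounded left approximate identity for the multiplication `mul`: a norm-bounded net,
encoded by the filter of its tails, along which `e ↦ mul e f` tends to `f`. The multiplication is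
an argument so that the notion covers opposite algebras and twisted convolution. -/
def HasBoundedLeftApproxIdentity {E : Type*} [SeminormedAddCommGroup E] (mul : E → E → E) : Prop :=
  ∃ l : Filter E, l.NeBot ∧ (∃ M : ℝ, ∀ᶠ e in l, ‖e‖ ≤ M) ∧ ∀ f, Tendsto (mul · f) l (𝓝 f)

theorem HasBoundedApproxIdentity.left {A : Type*} [NonUnitalNormedRing A]
    (h : HasBoundedApproxIdentity A) : HasBoundedLeftApproxIdentity fun a b : A => a * b :=
  let ⟨l, hl, hM⟩ := h
  ⟨l, hl.neBot, hM, hl.tendsto_mul_right⟩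

theorem HasBoundedApproxIdentity.right {A : Type*} [NonUnitalNormedRing A]
    (h : HasBoundedApproxIdentity A) : HasBoundedLeftApproxIdentity fun a b : A => b * a :=
  let ⟨l, hl, hM⟩ := h
  ⟨l, hl.neBot, hM, hl.tendsto_mul_left⟩

variable {𝕜 G A : Type*} [RCLike 𝕜]
  [Group G] [TopologicalSpace G] [IsTopologicalGroup G] [LocallyCompactSpace G] [T2Space G]
  [MeasurableSpace G] [BorelSpace G]

namespace WeightedCc

section Tensor

variable [NormedAddCommGroup A] [NormedSpace 𝕜 A] {μ : Measure G} [μ.IsHaarMeasure] [μ.Regular]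
  {ω : Weight G}

instance [NormedSpace ℝ A] [IsScalarTower ℝ 𝕜 A] : IsScalarTower ℝ 𝕜 (WeightedCc A μ ω) :=
  ⟨fun c d f => WeightedCc.ext fun s => smul_assoc c d (f s)⟩

variable (𝕜) in
/-- The elementary tensor `χ ⊗ a`, that is, `s ↦ χ(s) a`. -/
def tensor (χ : WeightedCc ℝ μ ω) (a : A) : WeightedCc A μ ω :=
  cutoff 𝕜 χ (.const G a)

@[simp] theorem tensor_apply (χ : WeightedCc ℝ μ ω) (a : A) (s : G) :
    tensor 𝕜 χ a s = (χ s : 𝕜) • a := rfl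

theorem norm_tensor_le (χ : WeightedCc ℝ μ ω) (a : A) : ‖tensor 𝕜 χ a‖ ≤ ‖a‖ * ‖χ‖ :=
  norm_le_of_forall_le _ χ ‖a‖ fun s => by simp [norm_smul, mul_comm]

end Tensor

end WeightedCc

variable [NonUnitalNormedRing A] [NormedSpace ℝ A] [NormedSpace 𝕜 A]
  [IsScalarTower 𝕜 A A] [SMulCommClass 𝕜 A A]
  (μ : Measure G) [μ.IsHaarMeasure] [μ.Regular] (ω : Weight G)

theorem tendsto_leftMul {l : Filter A} {M : ℝ} (hM : ∀ᶠ u in l, ‖u‖ ≤ M)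
    (hl : ∀ a, Tendsto (fun u => u * a) l (𝓝 a)) (f : WeightedCc A μ ω) :
    Tendsto (fun u => leftMul 𝕜 μ ω u f) l (𝓝 f) := by
  have hzero : ∀ s ∉ tsupport f, f s = 0 := fun s => image_eq_zero_of_notMem_tsupport
  refine WeightedCc.tendsto_of_compact f.hasCompactSupport.isCompact
    (.of_forall fun u s hs => by rw [leftMul_apply, hzero s hs, mul_zero]) hzero fun s _ => ?_
  exact tendsto_clm_apply_of_bounded (S := fun p : A × G => ContinuousLinearMap.mul 𝕜 A p.1)
    (tendsto_fst.eventually <| hM.mono fun u hu =>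
      (ContinuousLinearMap.opNorm_mul_apply_le 𝕜 A u).trans hu)
    ((hl (f s)).comp tendsto_fst) ((f.continuous.tendsto s).comp tendsto_snd)

namespace DynamicalSystem

variable (α : DynamicalSystem 𝕜 G A) (hα : α.UniformlyBounded)

include hα in
theorem tendsto_leftMul_translate {l : Filter A} {M : ℝ} (hM : ∀ᶠ u in l, ‖u‖ ≤ M)
    (hl : ∀ a, Tendsto (fun u => u * a) l (𝓝 a)) (f : WeightedCc A μ ω) :
    Tendsto (fun p : A × G => leftMul 𝕜 μ ω p.1 (α.translate μ ω p.2 f)) (l ×ˢ 𝓝 1) (𝓝 f) := by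
  have htranslate := (α.continuous_translate_apply μ ω hα f).tendsto 1
  rw [α.translate_one μ ω] at htranslate
  exact tendsto_clm_apply_of_bounded (S := fun p : A × G => leftMul 𝕜 μ ω p.1)
    (tendsto_fst.eventually <| hM.mono fun u hu => (norm_leftMul_le μ ω u).trans hu)
    ((tendsto_leftMul μ ω hM hl f).comp tendsto_fst) (htranslate.comp tendsto_snd)

variable [IsScalarTower ℝ 𝕜 A] [CompleteSpace A]

theorem ofCc_conv_tensor (χ : WeightedCc ℝ μ ω) (u : A) (f : WeightedCc A μ ω) :
    ofCc μ ω 𝕜 (α.conv μ ω hα (WeightedCc.tensor 𝕜 χ u) f) =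
      ∫ r, (χ r : 𝕜) • ofCc μ ω 𝕜 (leftMul 𝕜 μ ω u (α.translate μ ω r f)) ∂μ := by
  rw [α.map_conv_eq_integral μ ω]
  simp only [WeightedCc.tensor_apply, map_smul, smul_apply]

theorem hasBoundedLeftApproxIdentity_conv
    (hA : HasBoundedLeftApproxIdentity fun a b : A => a * b) :
    HasBoundedLeftApproxIdentity (α.conv μ ω hα) := by
  obtain ⟨l, hl, ⟨M, hM⟩, hlim⟩ := hA
  obtain ⟨C, hC⟩ := ω.exists_nhds_le μ 1
  refine ⟨map (fun p : A × Bump μ => .tensor 𝕜 (p.2.toWeightedCc ω) p.1) (l ×ˢ Bump.shrinking μ),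
    inferInstance, ⟨M * C, ?_⟩, fun f => ?_⟩
  · rw [eventually_map]
    filter_upwards [hM.prod_mk (Bump.eventually_support_subset hC)] with p hp
    exact (WeightedCc.norm_tensor_le _ _).trans <|
      mul_le_mul hp.1 (p.2.norm_toWeightedCc_le fun r hr => hp.2 hr) (norm_nonneg _)
        ((norm_nonneg _).trans hp.1)
  · rw [(UniformSpace.Completion.isUniformInducing_coe _).isInducing.tendsto_nhds_iff,
      tendsto_map'_iff]
    have hint := Bump.tendsto_integral_smul (μ := μ) (𝕜 := 𝕜)
      (F := fun (u : A) r => ofCc μ ω 𝕜 (leftMul 𝕜 μ ω u (α.translate μ ω r f)))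
      (fun u => (ofCc μ ω 𝕜).continuous.comp
        ((leftMul 𝕜 μ ω u).continuous.comp (α.continuous_translate_apply μ ω hα f)))
      (((ofCc μ ω 𝕜).continuous.tendsto f).comp (α.tendsto_leftMul_translate μ ω hα hM hlim f))
    exact hint.congr fun p => (α.ofCc_conv_tensor μ ω hα _ _ f).symm

end DynamicalSystem

end ApproxIdentity

/-! ### Extending a non-degenerate representation to centralizers -/

section Extension

variable {𝕜 E X : Type*} [RCLike 𝕜] [NormedAddCommGroup E] [NormedSpace 𝕜 E]
  [NormedAddCommGroup X] [NormedSpace 𝕜 X] {T : E →L[𝕜] X →L[𝕜] X}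

namespace IsNondegenerate

theorem clm_ext (hT : IsNondegenerate T) {S₁ S₂ : X →L[𝕜] X}
    (h : ∀ e x, S₁ (T e x) = S₂ (T e x)) : S₁ = S₂ :=
  ContinuousLinearMap.ext_on hT fun _ ⟨e, x, hy⟩ => hy ▸ h e x

theorem of_forall_mem_closure {E' : Type*} [NormedAddCommGroup E'] [NormedSpace 𝕜 E']
    {T' : E' →L[𝕜] X →L[𝕜] X} (hT : IsNondegenerate T)
    (h : ∀ e x, T e x ∈ closure {y | ∃ e' x', T' e' x' = y}) : IsNondegenerate T' := by
  rw [IsNondegenerate, Submodule.dense_iff_topologicalClosure_eq_top] at hT ⊢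
  rw [eq_top_iff, ← hT]
  refine Submodule.topologicalClosure_minimal _ (Submodule.span_le.2 ?_)
    (Submodule.isClosed_topologicalClosure _)
  rintro _ ⟨e, x, rfl⟩
  exact closure_mono Submodule.subset_span (h e x)

theorem of_tendsto {E' ι : Type*} [NormedAddCommGroup E'] [NormedSpace 𝕜 E']
    {T' : E' →L[𝕜] X →L[𝕜] X} {l : Filter ι} [l.NeBot] (hT : IsNondegenerate T)
    (h : ∀ e x, ∃ (u : ι → E') (y : X), Tendsto (fun i => T' (u i) y) l (𝓝 (T e x))) :
    IsNondegenerate T' := by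
  refine hT.of_forall_mem_closure fun e x => ?_
  obtain ⟨u, y, hlim⟩ := h e x
  exact mem_closure_of_tendsto hlim (.of_forall fun i => ⟨u i, y, rfl⟩)

theorem comp_iff {E' : Type*} [NormedAddCommGroup E'] [NormedSpace 𝕜 E'] {φ : E' →L[𝕜] E}
    (hφ : DenseRange φ) : IsNondegenerate (T.comp φ) ↔ IsNondegenerate T := by
  refine ⟨fun h => h.of_forall_mem_closure fun f x => subset_closure ⟨φ f, x, rfl⟩,
    fun h => h.of_forall_mem_closure fun e x => ?_⟩
  refine map_mem_closure (f := fun e => T e x) (T.continuous.clm_apply continuous_const) (hφ e) ?_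
  rintro _ ⟨f, rfl⟩
  exact ⟨f, x, rfl⟩

variable [CompleteSpace X]

theorem exists_centralizer_extension (hT : IsNondegenerate T) {mul : E → E → E}
    (hmul : ∀ e f, T (mul e f) = T e * T f) (hE : HasBoundedLeftApproxIdentity mul) :
    ∃ K : ℝ, ∀ m : E →L[𝕜] E, (∀ e f, m (mul e f) = mul (m e) f) →
      ∃ S : X →L[𝕜] X, ‖S‖ ≤ K * ‖m‖ ∧ ∀ f x, S (T f x) = T (m f) x := by
  obtain ⟨l, hl, ⟨M, hM⟩, hlim⟩ := hE
  refine ⟨‖T‖ * M, fun m hm => ?_⟩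
  have hbound : ∀ᶠ e in l, ‖T (m e)‖ ≤ ‖T‖ * M * ‖m‖ := by
    filter_upwards [hM] with e he
    calc ‖T (m e)‖ ≤ ‖T‖ * (‖m‖ * M) := T.le_of_opNorm_le_of_le le_rfl (m.le_opNorm_of_le he)
      _ = ‖T‖ * M * ‖m‖ := by ring
  have hrange : ∀ f x, Tendsto (fun e => T (m e) (T f x)) l (𝓝 (T (m f) x)) := fun f x => by
    have hcont : Continuous fun g => T (m g) x :=
      (T.continuous.comp m.continuous).clm_apply continuous_const
    refine ((hcont.tendsto f).comp (hlim f)).congr fun e => ?_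
    rw [Function.comp_apply, hm, hmul, mul_apply_eq_comp]
  obtain ⟨S, hS, hSlim⟩ := exists_tendsto_clm_apply_of_dense_span hbound hT
    fun _ ⟨f, x, hy⟩ => ⟨_, hy ▸ hrange f x⟩
  exact ⟨S, hS, fun f x => tendsto_nhds_unique (hSlim _) (hrange f x)⟩

end IsNondegenerate

end Extension

section Intertwining

variable {𝕜 G A X : Type*} [RCLike 𝕜]
  [Group G] [TopologicalSpace G] [IsTopologicalGroup G] [LocallyCompactSpace G] [T2Space G]
  [MeasurableSpace G] [BorelSpace G]
  [NonUnitalNormedRing A] [NormedSpace 𝕜 A] [IsScalarTower 𝕜 A A] [SMulCommClass 𝕜 A A]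
  [NormedAddCommGroup X] [NormedSpace 𝕜 X]
  {μ : Measure G} [μ.IsHaarMeasure] [μ.Regular] {ω : Weight G}
  {α : DynamicalSystem 𝕜 G A}

/-- `T` intertwines the actions of `A` and `G` on `C_c(G, A)` with `π` and `U`. When `T` is a
non-degenerate representation, this determines `π` and `U`, and it is how they are constructed. -/
structure Intertwines (α : DynamicalSystem 𝕜 G A) (T : WeightedCc A μ ω →L[𝕜] X →L[𝕜] X)
    (π : A →L[𝕜] X →L[𝕜] X) (U : G → X →L[𝕜] X) : Prop where
  map_leftMul : ∀ a f x, T (leftMul 𝕜 μ ω a f) x = π a (T f x)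
  map_translate : ∀ r f x, T (α.translate μ ω r f) x = U r (T f x)

variable {T : WeightedCc A μ ω →L[𝕜] X →L[𝕜] X} {π : A →L[𝕜] X →L[𝕜] X} {U : G → X →L[𝕜] X}

namespace Intertwines

theorem unique (h : Intertwines α T π U) (hT : IsNondegenerate T) {π' : A →L[𝕜] X →L[𝕜] X}
    {U' : G → X →L[𝕜] X} (h' : Intertwines α T π' U') : π' = π ∧ U' = U :=
  ⟨ContinuousLinearMap.ext fun a => hT.clm_ext fun f x => by
      rw [← h'.map_leftMul, h.map_leftMul],
    funext fun r => hT.clm_ext fun f x => by rw [← h'.map_translate, h.map_translate]⟩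

theorem commute (h : Intertwines α T π U) (hT : IsNondegenerate T) {S : X →L[𝕜] X}
    (hS : ∀ f, S * T f = T f * S) : (∀ a, S * π a = π a * S) ∧ ∀ r, S * U r = U r * S := by
  have hSapply : ∀ f x, S (T f x) = T f (S x) := fun f => DFunLike.congr_fun (hS f)
  refine ⟨fun a => hT.clm_ext fun f x => ?_, fun r => hT.clm_ext fun f x => ?_⟩
  · simp only [mul_apply_eq_comp, ← h.map_leftMul, hSapply]
  · simp only [mul_apply_eq_comp, ← h.map_translate, hSapply]

variable [NormedSpace ℝ A]

theorem continuous (h : Intertwines α T π U) (hT : IsNondegenerate T) (hα : α.UniformlyBounded)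
    (hU : WeightBounded U ω) (x : X) : Continuous fun r => U r x := by
  rw [continuous_iff_continuousAt]
  intro r₀
  obtain ⟨C, hC⟩ := hU
  obtain ⟨W, hW⟩ := ω.exists_nhds_le μ r₀
  have hbound : ∀ᶠ r in 𝓝 r₀, ‖U r‖ ≤ |C| * W := by
    filter_upwards [hW] with r hr
    have hr' : (ω r : ℝ) ≤ W := by exact_mod_cast hr
    exact (hC r).trans (mul_le_mul (le_abs_self C) hr' (ω r).coe_nonneg (abs_nonneg C))
  refine tendsto_clm_apply_of_dense_span hbound (U r₀) hT ?_ x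
  rintro _ ⟨f, y, rfl⟩
  simp only [← h.map_translate]
  exact ((T.continuous.comp (α.continuous_translate_apply μ ω hα f)).clm_apply
    continuous_const).tendsto r₀

theorem isCovariantRep (h : Intertwines α T π U) (hT : IsNondegenerate T)
    (hα : α.UniformlyBounded) (hA : HasBoundedLeftApproxIdentity fun a b : A => a * b)
    (hU : WeightBounded U ω) : IsCovariantRep α π U where
  map_mul a b := hT.clm_ext fun f x => by
    simp only [mul_apply_eq_comp, ← h.map_leftMul, leftMul_mul]
  nondegenerate := by
    obtain ⟨l, hl, ⟨M, hM⟩, hlim⟩ := hA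
    refine hT.of_tendsto (l := l) fun f x => ⟨id, T f x, ?_⟩
    simp only [id, ← h.map_leftMul]
    exact ((T.continuous.clm_apply continuous_const).tendsto f).comp
      (tendsto_leftMul μ ω hM hlim f)
  group_one := hT.clm_ext fun f x => by
    rw [← h.map_translate, α.translate_one μ ω, one_apply_eq_self]
  group_mul r s := hT.clm_ext fun f x => by
    simp only [mul_apply_eq_comp, ← h.map_translate, α.translate_mul μ ω]
  continuous := h.continuous hT hα hU
  covariant a r := hT.clm_ext fun f x => by
    simp only [mul_apply_eq_comp, ← h.map_translate, ← h.map_leftMul, α.translate_leftMul μ ω,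
      ← α.translate_mul μ ω, mul_inv_cancel, α.translate_one μ ω]

end Intertwines

variable [NormedSpace ℝ A] [IsScalarTower ℝ 𝕜 A] [CompleteSpace A] [CompleteSpace X]

theorem IsNondegenerate.exists_intertwines (hT : IsNondegenerate T) (hα : α.UniformlyBounded)
    (hmul : ∀ f g, T (α.conv μ ω hα f g) = T f * T g)
    (hCc : HasBoundedLeftApproxIdentity (α.conv μ ω hα)) :
    ∃ (π : A →L[𝕜] X →L[𝕜] X) (U : G → X →L[𝕜] X), WeightBounded U ω ∧ Intertwines α T π U := by
  obtain ⟨K, hK⟩ := hT.exists_centralizer_extension hmul hCc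
  choose π hπK hπ using fun a => hK (leftMul 𝕜 μ ω a) (α.leftMul_conv μ ω hα a)
  choose U hUK hU using fun r => hK (α.translate μ ω r) (α.translate_conv μ ω hα r)
  obtain ⟨C, hC⟩ := hα
  let πₗ : A →ₗ[𝕜] X →L[𝕜] X :=
    { toFun := π
      map_add' := fun a b => hT.clm_ext fun f x => by simp [hπ]
      map_smul' := fun c a => hT.clm_ext fun f x => by simp [hπ] }
  refine ⟨πₗ.mkContinuous |K| fun a => ?_, U, ⟨|K| * C, fun r => ?_⟩,
    fun a f x => (hπ a f x).symm, fun r f x => (hU r f x).symm⟩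
  · calc ‖π a‖ ≤ K * ‖leftMul 𝕜 μ ω a‖ := hπK a
      _ ≤ |K| * ‖a‖ := by gcongr; exacts [le_abs_self K, norm_leftMul_le μ ω a]
  · calc ‖U r‖ ≤ K * ‖α.translate μ ω r‖ := hUK r
      _ ≤ |K| * (C * ω r) := by
        gcongr
        · exact le_abs_self K
        · exact (α.norm_translate_le μ ω r).trans (by gcongr; exact hC r)
      _ = |K| * C * ω r := (mul_assoc _ _ _).symm

end Intertwining

/-! ### Integrated forms on `C_c(G, A)` -/

section IntegratedForm

theorem IsCovariantRep.apply_apply {𝕜 G A X : Type*} [RCLike 𝕜] [Group G]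
    [TopologicalSpace G] [NonUnitalNormedRing A] [NormedSpace 𝕜 A] [NormedAddCommGroup X]
    [NormedSpace 𝕜 X] {α : DynamicalSystem 𝕜 G A} {π : A →L[𝕜] X →L[𝕜] X} {U : G → X →L[𝕜] X}
    (h : IsCovariantRep α π U) (r : G) (a : A) (x : X) :
    U r (π a x) = π (α.act r a) (U r x) := by
  have hinv : U r⁻¹ (U r x) = x := by
    rw [← mul_apply_eq_comp, ← h.group_mul, inv_mul_cancel, h.group_one, one_apply_eq_self]
  rw [← h.covariant, mul_apply_eq_comp, mul_apply_eq_comp, hinv]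

variable {𝕜 G A X : Type*} [RCLike 𝕜]
  [Group G] [TopologicalSpace G] [IsTopologicalGroup G] [LocallyCompactSpace G] [T2Space G]
  [MeasurableSpace G] [BorelSpace G]
  [NonUnitalNormedRing A] [NormedSpace 𝕜 A]
  [NormedAddCommGroup X] [NormedSpace 𝕜 X]
  {μ : Measure G} [μ.IsHaarMeasure] [μ.Regular] {ω : Weight G}
  {α : DynamicalSystem 𝕜 G A} {π : A →L[𝕜] X →L[𝕜] X} {U : G → X →L[𝕜] X}
  {T : WeightedCc A μ ω →L[𝕜] X →L[𝕜] X}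

theorem integrable_clm_apply_apply (π : A →L[𝕜] X →L[𝕜] X) (hU : ∀ x, Continuous fun r => U r x)
    (f : WeightedCc A μ ω) (x : X) : Integrable (fun r => π (f r) (U r x)) μ :=
  ((π.continuous.comp f.continuous).clm_apply (hU x)).integrable_of_hasCompactSupport <|
    f.hasCompactSupport.mono fun r hr h => hr (by simp [h])

variable [NormedSpace ℝ X]

/-- `T` is the integrated form of `π` and `U`, where `T` is defined on `C_c(G, A)` only. -/
def IsIntegratedOnCc (π : A →L[𝕜] X →L[𝕜] X) (U : G → X →L[𝕜] X)
    (T : WeightedCc A μ ω →L[𝕜] X →L[𝕜] X) : Prop :=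
  ∀ (f : WeightedCc A μ ω) (x : X), T f x = ∫ r, π (f r) (U r x) ∂μ

theorem norm_integral_clm_apply_apply_le {C : ℝ} (hC : ∀ r, ‖U r‖ ≤ C * ω r) (f : WeightedCc A μ ω)
    (x : X) : ‖∫ r, π (f r) (U r x) ∂μ‖ ≤ ‖π‖ * C * ‖f‖ * ‖x‖ := by
  have hpointwise : ∀ r, ‖π (f r) (U r x)‖ ≤ ‖π‖ * C * ‖x‖ * (‖f r‖ * (ω r : ℝ)) := fun r =>
    calc ‖π (f r) (U r x)‖ ≤ ‖π‖ * ‖f r‖ * ‖U r x‖ := π.le_opNorm₂ _ _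
      _ ≤ ‖π‖ * ‖f r‖ * (C * ω r * ‖x‖) := by gcongr; exact (U r).le_of_opNorm_le (hC r) x
      _ = ‖π‖ * C * ‖x‖ * (‖f r‖ * (ω r : ℝ)) := by ring
  calc ‖∫ r, π (f r) (U r x) ∂μ‖ ≤ ∫ r, ‖π‖ * C * ‖x‖ * (‖f r‖ * (ω r : ℝ)) ∂μ :=
        norm_integral_le_of_norm_le (f.integrable_norm_mul.const_mul _) (.of_forall hpointwise)
    _ = ‖π‖ * C * ‖f‖ * ‖x‖ := by rw [integral_const_mul, WeightedCc.norm_def]; ring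

theorem exists_isIntegratedOnCc [IsScalarTower ℝ 𝕜 X] (π : A →L[𝕜] X →L[𝕜] X)
    (hU : ∀ x, Continuous fun r => U r x) (hω : WeightBounded U ω) :
    ∃ T : WeightedCc A μ ω →L[𝕜] X →L[𝕜] X, IsIntegratedOnCc π U T := by
  obtain ⟨C, hC⟩ := hω
  have hint := fun (f : WeightedCc A μ ω) x => integrable_clm_apply_apply π hU f x
  exact ⟨(LinearMap.mk₂ 𝕜 (fun f x => ∫ r, π (f r) (U r x) ∂μ)
    (fun f g x => by simp [integral_add (hint f x) (hint g x)])
    (fun c f x => by simp [integral_smul])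
    (fun f x y => by simp [integral_add (hint f x) (hint f y)])
    (fun c f x => by simp [integral_smul])).mkContinuous₂ (‖π‖ * C)
      (norm_integral_clm_apply_apply_le hC), fun _ _ => rfl⟩

variable [CompleteSpace X]

namespace IsIntegratedOnCc

theorem commute (hT : IsIntegratedOnCc π U T) (hU : ∀ x, Continuous fun r => U r x)
    {S : X →L[𝕜] X} (hSπ : ∀ a, S * π a = π a * S) (hSU : ∀ r, S * U r = U r * S)
    (f : WeightedCc A μ ω) : S * T f = T f * S := by
  have hSπ' : ∀ a y, S (π a y) = π a (S y) := fun a => DFunLike.congr_fun (hSπ a)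
  have hSU' : ∀ r y, S (U r y) = U r (S y) := fun r => DFunLike.congr_fun (hSU r)
  ext x
  rw [mul_apply_eq_comp, mul_apply_eq_comp, hT, hT,
    ← S.integral_comp_comm (integrable_clm_apply_apply π hU f x)]
  simp only [hSπ', hSU']

theorem isNondegenerate [IsScalarTower ℝ 𝕜 X] (hT : IsIntegratedOnCc π U T)
    (h : IsCovariantRep α π U) : IsNondegenerate T := by
  refine h.nondegenerate.of_tendsto (l := Bump.shrinking μ) fun a x =>
    ⟨fun φ => .tensor 𝕜 (φ.toWeightedCc ω) a, x, ?_⟩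
  have hlim := Bump.tendsto_integral_smul_of_continuous (μ := μ) (𝕜 := 𝕜)
    ((π a).continuous.comp (h.continuous x))
  rw [Function.comp_apply, h.group_one] at hlim
  refine hlim.congr fun φ => ?_
  rw [hT]
  simp

variable [IsScalarTower 𝕜 A A] [SMulCommClass 𝕜 A A]

theorem intertwines (hT : IsIntegratedOnCc π U T) (h : IsCovariantRep α π U) :
    Intertwines α T π U where
  map_leftMul a f x := by
    rw [hT, hT, ← (π a).integral_comp_comm (integrable_clm_apply_apply π h.continuous f x)]
    simp [h.map_mul]
  map_translate t f x := by
    rw [hT, hT, ← (U t).integral_comp_comm (integrable_clm_apply_apply π h.continuous f x),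
      ← integral_mul_left_eq_self (fun r => π (α.translate μ ω t f r) (U r x)) t]
    simp [h.apply_apply, h.group_mul]

end IsIntegratedOnCc

variable [IsScalarTower 𝕜 A A] [SMulCommClass 𝕜 A A]
  [NormedSpace ℝ A] [IsScalarTower ℝ 𝕜 A] [CompleteSpace A]

theorem Intertwines.map_conv_apply (h : Intertwines α T π U) (hα : α.UniformlyBounded)
    (f g : WeightedCc A μ ω) (x : X) :
    T (α.conv μ ω hα f g) x = ∫ r, π (f r) (U r (T g x)) ∂μ := by
  have hx := α.map_conv_eq_integral μ ω hα ((ContinuousLinearMap.apply 𝕜 X x).comp T) f g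
  simpa only [ContinuousLinearMap.comp_apply, ContinuousLinearMap.apply_apply, h.map_leftMul,
    h.map_translate] using hx

theorem IsIntegratedOnCc.map_conv (hT : IsIntegratedOnCc π U T) (h : IsCovariantRep α π U)
    (hα : α.UniformlyBounded) (f g : WeightedCc A μ ω) :
    T (α.conv μ ω hα f g) = T f * T g := by
  ext x
  rw [(hT.intertwines h).map_conv_apply hα, mul_apply_eq_comp, hT f]

variable [IsScalarTower ℝ 𝕜 X]

theorem Intertwines.isIntegratedOnCc (h : Intertwines α T π U) (hT : IsNondegenerate T)
    (hα : α.UniformlyBounded) (hmul : ∀ f g, T (α.conv μ ω hα f g) = T f * T g)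
    (hU : ∀ x, Continuous fun r => U r x) (hω : WeightBounded U ω) : IsIntegratedOnCc π U T := by
  obtain ⟨T', hT'⟩ := exists_isIntegratedOnCc (μ := μ) π hU hω
  suffices hTT' : T' = T from hTT' ▸ hT'
  refine ContinuousLinearMap.ext fun f => hT.clm_ext fun g x => ?_
  rw [hT', ← h.map_conv_apply hα, hmul, mul_apply_eq_comp]

theorem IsNondegenerate.exists_isIntegratedOnCc (hT : IsNondegenerate T)
    (hα : α.UniformlyBounded) (hA : HasBoundedLeftApproxIdentity fun a b : A => a * b)
    (hmul : ∀ f g, T (α.conv μ ω hα f g) = T f * T g) :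
    ∃ (π : A →L[𝕜] X →L[𝕜] X) (U : G → X →L[𝕜] X), IsCovariantRep α π U ∧ WeightBounded U ω ∧
      IsIntegratedOnCc π U T := by
  obtain ⟨π, U, hω, h⟩ :=
    hT.exists_intertwines hα hmul (α.hasBoundedLeftApproxIdentity_conv μ ω hα hA)
  have hcov := h.isCovariantRep hT hα hA hω
  exact ⟨π, U, hcov, hω, h.isIntegratedOnCc hT hα hmul hcov.continuous hω⟩

end IntegratedForm

/-! ### Integrated forms on the completion -/

section Dense

variable {𝕜 G A : Type*} [RCLike 𝕜]
  [Group G] [TopologicalSpace G] [IsTopologicalGroup G] [LocallyCompactSpace G] [T2Space G]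
  [MeasurableSpace G] [BorelSpace G] [NormedAddCommGroup A] [NormedSpace 𝕜 A]
  {μ : Measure G} [μ.IsHaarMeasure] [μ.Regular] {ω : Weight G}

variable (𝕜 μ ω) in
theorem denseRange_ofCc :
    DenseRange (ofCc μ ω 𝕜 : WeightedCc A μ ω →L[𝕜] BeurlingSpace A μ ω) :=
  UniformSpace.Completion.denseRange_coe

variable (𝕜 μ ω) in
theorem isUniformInducing_ofCc :
    IsUniformInducing (ofCc μ ω 𝕜 : WeightedCc A μ ω →L[𝕜] BeurlingSpace A μ ω) :=
  UniformSpace.Completion.isUniformInducing_coe _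

@[simp] theorem norm_ofCc (f : WeightedCc A μ ω) : ‖ofCc μ ω 𝕜 f‖ = ‖f‖ :=
  UniformSpace.Completion.norm_coe f

theorem beurlingSpace_clm_ext {Y : Type*} [NormedAddCommGroup Y] [NormedSpace 𝕜 Y]
    {T₁ T₂ : BeurlingSpace A μ ω →L[𝕜] Y} (h : T₁.comp (ofCc μ ω 𝕜) = T₂.comp (ofCc μ ω 𝕜)) :
    T₁ = T₂ :=
  DFunLike.coe_injective <| (denseRange_ofCc 𝕜 μ ω).equalizer T₁.continuous T₂.continuous <|
    congrArg DFunLike.coe h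

theorem commute_comp_ofCc_iff {X : Type*} [NormedAddCommGroup X] [NormedSpace 𝕜 X]
    {T : BeurlingSpace A μ ω →L[𝕜] X →L[𝕜] X} {S : X →L[𝕜] X} :
    (∀ f, S * T.comp (ofCc μ ω 𝕜) f = T.comp (ofCc μ ω 𝕜) f * S) ↔ ∀ u, S * T u = T u * S :=
  ⟨fun h u => (denseRange_ofCc 𝕜 μ ω).induction_on u
    (isClosed_eq (continuous_const.mul T.continuous) (T.continuous.mul continuous_const)) h,
    fun h _ => h _⟩

end Dense

section Completion

variable {𝕜 G A X : Type*} [RCLike 𝕜]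
  [Group G] [TopologicalSpace G] [IsTopologicalGroup G] [LocallyCompactSpace G] [T2Space G]
  [MeasurableSpace G] [BorelSpace G]
  [NonUnitalNormedRing A] [NormedSpace 𝕜 A]
  [NormedAddCommGroup X] [NormedSpace 𝕜 X]
  {μ : Measure G} [μ.IsHaarMeasure] [μ.Regular] {ω : Weight G}
  {α : DynamicalSystem 𝕜 G A} {π : A →L[𝕜] X →L[𝕜] X} {U : G → X →L[𝕜] X}
  {T : BeurlingSpace A μ ω →L[𝕜] X →L[𝕜] X}

section Multiplicativity

variable [NormedSpace ℝ A] [IsScalarTower ℝ 𝕜 A] [IsScalarTower 𝕜 A A] [SMulCommClass 𝕜 A A]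
  [CompleteSpace A] {hα : α.UniformlyBounded}

theorem isBeurlingRep_iff_comp_ofCc :
    IsBeurlingRep α hα T ↔
      (∀ f g, T.comp (ofCc μ ω 𝕜) (α.conv μ ω hα f g) =
        T.comp (ofCc μ ω 𝕜) f * T.comp (ofCc μ ω 𝕜) g) ∧
      IsNondegenerate (T.comp (ofCc μ ω 𝕜)) := by
  rw [IsNondegenerate.comp_iff (T := T) (denseRange_ofCc 𝕜 μ ω)]
  simp only [ContinuousLinearMap.comp_apply, ← α.beurlingMul_ofCc μ ω]
  refine ⟨fun h => ⟨fun f g => h.map_mul _ _, h.nondegenerate⟩, fun h => ⟨fun u v => ?_, h.2⟩⟩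
  refine (denseRange_ofCc 𝕜 μ ω).induction_on₂ (isClosed_eq ?_ ?_) h.1 u v
  · exact T.continuous.comp (α.beurlingMul μ ω hα).continuous₂
  · exact (T.continuous.comp continuous_fst).mul (T.continuous.comp continuous_snd)

end Multiplicativity

variable [NormedSpace ℝ X]

theorem isIntegratedForm_iff_comp_ofCc :
    IsIntegratedForm π U T ↔ IsIntegratedOnCc π U (T.comp (ofCc μ ω 𝕜)) := Iff.rfl

variable [CompleteSpace X]

theorem existsUnique_isIntegratedForm [IsScalarTower ℝ 𝕜 X] (π : A →L[𝕜] X →L[𝕜] X)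
    (hU : ∀ x, Continuous fun r => U r x) (hω : WeightBounded U ω) :
    ∃! T : BeurlingSpace A μ ω →L[𝕜] X →L[𝕜] X, IsIntegratedForm π U T := by
  obtain ⟨S, hS⟩ := exists_isIntegratedOnCc (μ := μ) π hU hω
  have hext : ∀ f, S.extend (ofCc μ ω 𝕜) (ofCc μ ω 𝕜 f) = S f :=
    ContinuousLinearMap.extend_eq _ (denseRange_ofCc 𝕜 μ ω) (isUniformInducing_ofCc 𝕜 μ ω)
  refine ⟨S.extend (ofCc μ ω 𝕜), fun f x => by rw [hext, hS], fun T hT =>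
    beurlingSpace_clm_ext ?_⟩
  ext f x
  rw [ContinuousLinearMap.comp_apply, ContinuousLinearMap.comp_apply, hT, hext, hS]

variable [IsScalarTower ℝ 𝕜 X] [IsScalarTower 𝕜 A A] [SMulCommClass 𝕜 A A]

namespace IsIntegratedForm

theorem unique (hT : IsIntegratedForm π U T) (h : IsCovariantRep α π U)
    {π' : A →L[𝕜] X →L[𝕜] X} {U' : G → X →L[𝕜] X} (hT' : IsIntegratedForm π' U' T)
    (h' : IsCovariantRep α π' U') : π' = π ∧ U' = U := by
  rw [isIntegratedForm_iff_comp_ofCc] at hT hT'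
  exact (hT.intertwines h).unique (hT.isNondegenerate h) (hT'.intertwines h')

theorem commute_iff (hT : IsIntegratedForm π U T) (h : IsCovariantRep α π U) {S : X →L[𝕜] X} :
    (∀ u, S * T u = T u * S) ↔ (∀ a, S * π a = π a * S) ∧ ∀ r, S * U r = U r * S := by
  rw [isIntegratedForm_iff_comp_ofCc] at hT
  rw [← commute_comp_ofCc_iff]
  exact ⟨(hT.intertwines h).commute (hT.isNondegenerate h),
    fun hS => hT.commute h.continuous hS.1 hS.2⟩

end IsIntegratedForm

variable [NormedSpace ℝ A] [IsScalarTower ℝ 𝕜 A] [CompleteSpace A]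

theorem IsIntegratedForm.isBeurlingRep (hT : IsIntegratedForm π U T) (h : IsCovariantRep α π U)
    (hα : α.UniformlyBounded) : IsBeurlingRep α hα T := by
  rw [isIntegratedForm_iff_comp_ofCc] at hT
  exact isBeurlingRep_iff_comp_ofCc.2 ⟨hT.map_conv h hα, hT.isNondegenerate h⟩

theorem IsBeurlingRep.exists_isIntegratedForm {hα : α.UniformlyBounded}
    (hT : IsBeurlingRep α hα T) (hA : HasBoundedLeftApproxIdentity fun a b : A => a * b) :
    ∃ (π : A →L[𝕜] X →L[𝕜] X) (U : G → X →L[𝕜] X), IsCovariantRep α π U ∧ WeightBounded U ω ∧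
      IsIntegratedForm π U T := by
  obtain ⟨hmul, hnondeg⟩ := isBeurlingRep_iff_comp_ofCc.1 hT
  exact hnondeg.exists_isIntegratedOnCc hα hA hmul

end Completion

/-! ### The modular function -/

section Modular

open Measure

theorem modularCharacterFun_inv {G : Type*} [Group G] [TopologicalSpace G] [IsTopologicalGroup G]
    [LocallyCompactSpace G] (g : G) : modularCharacterFun g⁻¹ = (modularCharacterFun g)⁻¹ :=
  eq_inv_of_mul_eq_one_left <| by
    rw [← modularCharacterFun_map_mul, inv_mul_cancel, modularCharacterFun_map_one]

variable {G : Type*} [Group G] [TopologicalSpace G] [IsTopologicalGroup G] [LocallyCompactSpace G]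
  [MeasurableSpace G] [BorelSpace G] (μ : Measure G)

section Haar

variable [μ.IsHaarMeasure] [μ.Regular]

theorem map_mul_right_eq_modularCharacterFun_smul (g : G) :
    map (· * g) μ = modularCharacterFun g • μ := by
  have : (map (· * g) μ).Regular := Regular.map (Homeomorph.mulRight g)
  rw [modularCharacterFun_eq_haarScalarFactor μ g]
  exact isMulLeftInvariant_eq_smul_of_regular _ μ

theorem integral_mul_right_eq_modularCharacterFun_smul {E : Type*} [NormedAddCommGroup E]
    [NormedSpace ℝ E] (F : G → E) (g : G) :
    ∫ s, F (s * g) ∂μ = modularCharacterFun g • ∫ s, F s ∂μ := by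
  rw [← integral_smul_nnreal_measure, ← map_mul_right_eq_modularCharacterFun_smul]
  exact (integral_map_equiv (MeasurableEquiv.mulRight g) F).symm

theorem integral_inv_mul_eq_modularCharacterFun_smul {E : Type*} [NormedAddCommGroup E]
    [NormedSpace ℝ E] (F : G → E) (g : G) :
    ∫ s, F (s⁻¹ * g) ∂μ.inv = modularCharacterFun g • ∫ s, F s ∂μ := by
  rw [← integral_mul_right_eq_modularCharacterFun_smul]
  exact (integral_map_equiv (MeasurableEquiv.inv G) fun s => F (s⁻¹ * g)).trans (by simp)

end Haar

theorem continuous_modularCharacterFun {G : Type*} [Group G] [TopologicalSpace G]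
    [IsTopologicalGroup G] [LocallyCompactSpace G] :
    Continuous (modularCharacterFun : G → ℝ≥0) := by
  borelize G
  let μ : Measure G := haar
  obtain ⟨⟨f, hf⟩, hfs, hf0, hf1⟩ :
    ∃ f : C(G, ℝ), HasCompactSupport f ∧ 0 ≤ f ∧ f 1 ≠ 0 := exists_continuous_nonneg_pos 1
  have hpos : ∫ x, f x ∂μ ≠ 0 :=
    (hf.integral_pos_of_hasCompactSupport_nonneg_nonzero hfs hf0 hf1).ne'
  rw [NNReal.isEmbedding_coe.continuous_iff]
  refine ((continuous_integral_apply_inv_mul (μ := μ.inv) hf hfs).div_const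
    (∫ x, f x ∂μ)).congr fun g => ?_
  rw [integral_inv_mul_eq_modularCharacterFun_smul, NNReal.smul_def, smul_eq_mul,
    mul_div_cancel_right₀ _ hpos, Function.comp_apply]

/-- The image under inversion of the right Haar measure `Δ dμ`; it agrees with `μ` on compact
sets. -/
def invModular : Measure G :=
  (μ.withDensity fun s => (modularCharacterFun s : ENNReal)).map (MeasurableEquiv.inv G)

theorem lintegral_invModular {F : G → ENNReal} (hF : Measurable F) :
    ∫⁻ s, F s ∂invModular μ = ∫⁻ s, modularCharacterFun s * F s⁻¹ ∂μ := by
  rw [invModular, lintegral_map_equiv]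
  exact lintegral_withDensity_eq_lintegral_mul μ
    continuous_modularCharacterFun.measurable.coe_nnreal_ennreal (hF.comp measurable_inv)

theorem integral_invModular {E : Type*} [NormedAddCommGroup E] [NormedSpace ℝ E] (F : G → E) :
    ∫ s, F s ∂invModular μ = ∫ s, (modularCharacterFun s : ℝ) • F s⁻¹ ∂μ := by
  rw [invModular, integral_map_equiv, integral_withDensity_eq_integral_smul
    continuous_modularCharacterFun.measurable]
  rfl

variable [μ.IsHaarMeasure] [μ.Regular]

theorem integral_modularCharacterFun_mul_inv_of_continuous {f : G → ℝ} (hf : Continuous f)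
    (hfs : HasCompactSupport f) :
    ∫ s, (modularCharacterFun s : ℝ) * f s⁻¹ ∂μ = ∫ s, f s ∂μ := by
  obtain ⟨⟨g, hg⟩, hgs, hg0, hg1⟩ :
    ∃ g : C(G, ℝ), HasCompactSupport g ∧ 0 ≤ g ∧ g 1 ≠ 0 := exists_continuous_nonneg_pos 1
  have hpos : ∫ x, g x ∂μ ≠ 0 :=
    (hg.integral_pos_of_hasCompactSupport_nonneg_nonzero hgs hg0 hg1).ne'
  have hinv : ∫ s, f s * (modularCharacterFun s : ℝ)⁻¹ ∂μ.inv =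
      ∫ s, (modularCharacterFun s : ℝ) * f s⁻¹ ∂μ := by
    refine (integral_map_equiv (MeasurableEquiv.inv G) _).trans (integral_congr_ae (.of_forall ?_))
    intro s
    simp [modularCharacterFun_inv, mul_comm]
  rw [integral_isMulLeftInvariant_isMulRightInvariant_combo (μ := μ) (ν := μ.inv) hf hfs hg hgs
    hg0 hg1, ← hinv, ← integral_mul_const]
  simp only [integral_inv_mul_eq_modularCharacterFun_smul, NNReal.smul_def, smul_eq_mul, mul_inv,
    mul_assoc, inv_mul_cancel₀ hpos, mul_one]

theorem lintegral_mul_right_eq_modularCharacterFun_mul {F : G → ENNReal} (hF : Measurable F)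
    (g : G) : ∫⁻ s, F (s * g) ∂μ = modularCharacterFun g * ∫⁻ s, F s ∂μ := by
  rw [← lintegral_map hF (measurable_mul_const g), map_mul_right_eq_modularCharacterFun_smul,
    lintegral_smul_measure, ENNReal.smul_def, smul_eq_mul]

instance : (invModular μ).IsMulLeftInvariant := by
  refine ⟨fun t => Measure.ext_of_lintegral _ fun F hF => ?_⟩
  have hΔ : Measurable fun s : G => (modularCharacterFun s : ENNReal) :=
    continuous_modularCharacterFun.measurable.coe_nnreal_ennreal
  have hFt : Measurable fun s => F (t * s) := hF.comp (measurable_const_mul t)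
  have hΔF : Measurable fun s => (modularCharacterFun s : ENNReal) * F (t * s⁻¹) :=
    hΔ.mul (hFt.comp measurable_inv)
  rw [lintegral_map hF (measurable_const_mul t), lintegral_invModular μ hF,
    lintegral_invModular μ hFt]
  have ht0 : (modularCharacterFun t : ENNReal) ≠ 0 := by
    simpa using (modularCharacterFun_pos t).ne'
  refine (ENNReal.mul_right_inj ht0 ENNReal.coe_ne_top).1 ?_
  rw [← lintegral_mul_right_eq_modularCharacterFun_mul μ hΔF,
    ← lintegral_const_mul' _ _ ENNReal.coe_ne_top]
  refine lintegral_congr fun s => ?_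
  simp only [modularCharacterFun_map_mul, mul_inv_rev,
    mul_inv_cancel_left, ENNReal.coe_mul]
  ring

instance : IsFiniteMeasureOnCompacts (invModular μ) := by
  have := IsLocallyFiniteMeasure.withDensity_coe (μ := μ)
    (continuous_modularCharacterFun (G := G))
  exact IsFiniteMeasureOnCompacts.map _ (Homeomorph.inv G)

theorem haarScalarFactor_invModular : haarScalarFactor (invModular μ) μ = 1 := by
  obtain ⟨⟨f, hf⟩, hfs, hf0, hf1⟩ :
    ∃ f : C(G, ℝ), HasCompactSupport f ∧ 0 ≤ f ∧ f 1 ≠ 0 := exists_continuous_nonneg_pos 1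
  have hpos : ∫ x, f x ∂μ ≠ 0 :=
    (hf.integral_pos_of_hasCompactSupport_nonneg_nonzero hfs hf0 hf1).ne'
  rw [← NNReal.coe_inj, haarScalarFactor_eq_integral_div _ _ hf hfs hpos, integral_invModular]
  simp only [smul_eq_mul]
  rw [integral_modularCharacterFun_mul_inv_of_continuous μ hf hfs, div_self hpos, NNReal.coe_one]

theorem integral_modularCharacterFun_smul_inv {E : Type*} [NormedAddCommGroup E] [NormedSpace ℝ E]
    {F : G → E} (hF : HasCompactSupport F) :
    ∫ s, (modularCharacterFun s : ℝ) • F s⁻¹ ∂μ = ∫ s, F s ∂μ := by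
  have hzero : ∀ s, s ∉ tsupport F → F s = 0 := fun _ => image_eq_zero_of_notMem_tsupport
  have hrestrict : (invModular μ).restrict (tsupport F) = μ.restrict (tsupport F) := by
    ext E hE
    rw [restrict_apply hE, restrict_apply hE,
      measure_isMulInvariant_eq_smul_of_isCompact_closure (invModular μ) μ
        (hF.isCompact.closure_of_subset Set.inter_subset_right),
      haarScalarFactor_invModular, one_smul]
  rw [← integral_invModular, ← setIntegral_eq_integral_of_forall_compl_eq_zero hzero, hrestrict,
    setIntegral_eq_integral_of_forall_compl_eq_zero hzero]

end Modular

/-! ### The opposite dynamical system -/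

open MulOpposite Measure

section Opposite

section OpL

variable (𝕜 A : Type*) [RCLike 𝕜] [NormedAddCommGroup A] [NormedSpace 𝕜 A]

/-- `MulOpposite.op` as a bounded operator. -/
def opL : A →L[𝕜] Aᵐᵒᵖ := (opContinuousLinearEquiv 𝕜 : A ≃L[𝕜] Aᵐᵒᵖ)

/-- `MulOpposite.unop` as a bounded operator. -/
def unopL : Aᵐᵒᵖ →L[𝕜] A := ((opContinuousLinearEquiv 𝕜 : A ≃L[𝕜] Aᵐᵒᵖ).symm : Aᵐᵒᵖ →L[𝕜] A)

variable {𝕜 A}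

@[simp] theorem opL_apply (a : A) : opL 𝕜 A a = op a := rfl

@[simp] theorem unopL_apply (a : Aᵐᵒᵖ) : unopL 𝕜 A a = unop a := rfl

end OpL

variable {𝕜 G A : Type*} [RCLike 𝕜] [Group G] [TopologicalSpace G]
  [NonUnitalNormedRing A] [NormedSpace 𝕜 A]

namespace DynamicalSystem

theorem act_mul_apply (α : DynamicalSystem 𝕜 G A) (r s : G) (a : A) :
    α.act (r * s) a = α.act r (α.act s a) := by
  rw [map_mul, mul_apply_eq_comp]

/-- The dynamical system `(Aᵒᵖ, G, α)`; the group is not replaced by its opposite. -/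
def opposite (α : DynamicalSystem 𝕜 G A) : DynamicalSystem 𝕜 G Aᵐᵒᵖ where
  act :=
    { toFun := fun r => opL 𝕜 A ∘L α.act r ∘L unopL 𝕜 A
      map_one' := by ext; simp
      map_mul' := fun r s => by ext; simp }
  act_mul r a b := congrArg op (α.act_mul r (unop b) (unop a))
  continuous_act a := continuous_op.comp (α.continuous_act (unop a))

@[simp] theorem opposite_act (α : DynamicalSystem 𝕜 G A) (r : G) (a : Aᵐᵒᵖ) :
    α.opposite.act r a = op (α.act r (unop a)) := rfl

theorem UniformlyBounded.opposite {α : DynamicalSystem 𝕜 G A} (hα : α.UniformlyBounded) :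
    α.opposite.UniformlyBounded := by
  obtain ⟨C, hC⟩ := hα
  refine ⟨C, fun r => ContinuousLinearMap.opNorm_le_bound _ ((norm_nonneg _).trans (hC r))
    fun a => ?_⟩
  rw [opposite_act, norm_op, ← norm_unop a]
  exact (α.act r).le_of_opNorm_le (hC r) _

end DynamicalSystem

end Opposite

section Reflect

variable {𝕜 G A B : Type*} [RCLike 𝕜] [Group G] [TopologicalSpace G] [IsTopologicalGroup G]

/-- The weight `s ↦ ω(s⁻¹)`. -/
def Weight.inv [MeasurableSpace G] [BorelSpace G] (ω : Weight G) : Weight G where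
  toFun s := ω s⁻¹
  measurable_toFun := ω.measurable_toFun.comp measurable_inv
  toFun_ne_zero h := (ω.pos 1).ne' (by simpa using congr_fun h 1)
  toFun_mul_le r s := by
    rw [mul_inv_rev, mul_comm]
    exact ω.toFun_mul_le _ _

@[simp] theorem Weight.inv_apply [MeasurableSpace G] [BorelSpace G] (ω : Weight G) (s : G) :
    ω.inv s = ω s⁻¹ := rfl

variable [LocallyCompactSpace G]

variable (𝕜) in
/-- The modular function of `G`, with values in `𝕜`. -/
def modular (s : G) : 𝕜 := ((modularCharacterFun s : ℝ) : 𝕜)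

theorem continuous_modular : Continuous (modular 𝕜 : G → 𝕜) :=
  RCLike.continuous_ofReal.comp (NNReal.continuous_coe.comp continuous_modularCharacterFun)

theorem norm_modular (s : G) : ‖modular 𝕜 s‖ = modularCharacterFun s := by
  rw [modular, RCLike.norm_ofReal, abs_of_nonneg (NNReal.coe_nonneg _)]

theorem modular_mul (r s : G) : modular 𝕜 (r * s) = modular 𝕜 r * modular 𝕜 s := by
  simp [modular, modularCharacterFun_map_mul]

theorem modular_mul_modular_inv (s : G) : modular 𝕜 s * modular 𝕜 s⁻¹ = 1 := by
  rw [← modular_mul, mul_inv_cancel]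
  simp [modular, modularCharacterFun_map_one]

variable [T2Space G] [MeasurableSpace G] [BorelSpace G] [NonUnitalNormedRing A]
  [NormedAddCommGroup B] (μ : Measure G) [μ.IsHaarMeasure] [μ.Regular] (ω ω' : Weight G)

variable {μ ω} in
theorem WeightedCc.integrable_modularCharacterFun_smul_inv (f : WeightedCc A μ ω) :
    Integrable (fun s => (modularCharacterFun s : ℝ) • (‖f s⁻¹‖ * ω s⁻¹)) μ := by
  have hf : Continuous fun s => (modularCharacterFun s : ℝ) * ‖f s⁻¹‖ :=
    (NNReal.continuous_coe.comp continuous_modularCharacterFun).mul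
      (f.continuous.comp continuous_inv).norm
  have hfs : HasCompactSupport fun s => (modularCharacterFun s : ℝ) * ‖f s⁻¹‖ :=
    (f.hasCompactSupport.comp_homeomorph (Homeomorph.inv G)).norm.mul_left
  exact (ω.inv.integrable_mul μ _ hf hfs).congr (.of_forall fun s => mul_assoc _ _ _)

variable [NormedSpace 𝕜 A] [NormedSpace 𝕜 B]

variable (α : DynamicalSystem 𝕜 G A) (hα : α.UniformlyBounded)

/-- The map `f ↦ (s ↦ Δ(s) L(α_s(f(s⁻¹))))` from `C_c(G, A)` to `C_c(G, B)`, for a bounded operator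
`L : A → B` and `ω'(s) = ω(s⁻¹)`. -/
def reflect (L : A →L[𝕜] B) (hω : ∀ s, ω' s = ω s⁻¹) : WeightedCc A μ ω →L[𝕜] WeightedCc B μ ω' :=
  LinearMap.mkContinuousOfExistsBound
    { toFun := fun f => .mk μ ω' (fun s => modular 𝕜 s • L (α.act s (f s⁻¹)))
        (continuous_modular.smul (L.continuous.comp ((α.continuous_uncurry hα).comp
          (continuous_id.prodMk (f.continuous.comp continuous_inv)))))
        ((f.hasCompactSupport.comp_homeomorph (Homeomorph.inv G)).mono fun s hs h0 =>
          have h0 : f s⁻¹ = 0 := h0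
          hs (by simp [h0]))
      map_add' := fun f g => WeightedCc.ext fun s => by simp
      map_smul' := fun c f => WeightedCc.ext fun s => by simp [smul_comm (modular 𝕜 s) c] } <| by
    obtain ⟨C, hC⟩ := hα
    refine ⟨‖L‖ * C, fun f => ?_⟩
    have hfs : HasCompactSupport fun s => ‖f s‖ * (ω s : ℝ) := f.hasCompactSupport.norm.mul_right
    rw [WeightedCc.norm_def, WeightedCc.norm_def, ← integral_modularCharacterFun_smul_inv μ hfs,
      ← integral_const_mul]
    refine integral_mono (WeightedCc.integrable_norm_mul _)
      (f.integrable_modularCharacterFun_smul_inv.const_mul _) fun s => ?_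
    calc ‖modular 𝕜 s • L (α.act s (f s⁻¹))‖ * (ω' s : ℝ)
        ≤ (modularCharacterFun s : ℝ) * (‖L‖ * (C * ‖f s⁻¹‖)) * ω s⁻¹ := by
          rw [norm_smul, norm_modular, hω]
          gcongr
          exact L.le_opNorm_of_le ((α.act s).le_of_opNorm_le (hC s) _)
      _ = ‖L‖ * C * ((modularCharacterFun s : ℝ) • (‖f s⁻¹‖ * ω s⁻¹)) := by
          rw [smul_eq_mul]
          ring

@[simp] theorem reflect_apply (L : A →L[𝕜] B) (hω : ∀ s, ω' s = ω s⁻¹) (f : WeightedCc A μ ω)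
    (s : G) : reflect μ ω ω' α hα L hω f s = modular 𝕜 s • L (α.act s (f s⁻¹)) := rfl

end Reflect

section Congr

variable {𝕜 G H A B : Type*} [RCLike 𝕜]
  [Group G] [TopologicalSpace G] [IsTopologicalGroup G] [LocallyCompactSpace G] [T2Space G]
  [MeasurableSpace G] [BorelSpace G]
  [Group H] [TopologicalSpace H] [IsTopologicalGroup H] [LocallyCompactSpace H] [T2Space H]
  [MeasurableSpace H] [BorelSpace H]
  [NormedAddCommGroup A] [NormedSpace 𝕜 A] [NormedAddCommGroup B] [NormedSpace 𝕜 B]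
  {μ : Measure G} [μ.IsHaarMeasure] [μ.Regular] {ω : Weight G}
  {ν : Measure H} [ν.IsHaarMeasure] [ν.Regular] {η : Weight H}

theorem exists_norm_ofCc_apply_le (φ : WeightedCc A μ ω →L[𝕜] WeightedCc B ν η) :
    ∃ C, ∀ f, ‖ofCc ν η 𝕜 (φ f)‖ ≤ C * ‖ofCc μ ω 𝕜 f‖ :=
  ⟨‖φ‖, fun f => by simpa only [norm_ofCc] using φ.le_opNorm f⟩

/-- The isomorphism of completions induced by an isomorphism of spaces of continuous compactly
supported functions. -/
def beurlingSpaceCongr (φ : WeightedCc A μ ω ≃L[𝕜] WeightedCc B ν η) :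
    BeurlingSpace A μ ω ≃L[𝕜] BeurlingSpace B ν η :=
  φ.toLinearEquiv.extend (ofCc μ ω 𝕜).toLinearMap (ofCc ν η 𝕜).toLinearMap
    (denseRange_ofCc 𝕜 μ ω) (exists_norm_ofCc_apply_le φ.toContinuousLinearMap)
    (denseRange_ofCc 𝕜 ν η) (exists_norm_ofCc_apply_le φ.symm.toContinuousLinearMap)

theorem beurlingSpaceCongr_ofCc (φ : WeightedCc A μ ω ≃L[𝕜] WeightedCc B ν η)
    (f : WeightedCc A μ ω) : beurlingSpaceCongr φ (ofCc μ ω 𝕜 f) = ofCc ν η 𝕜 (φ f) :=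
  LinearMap.extendOfNorm_eq (denseRange_ofCc 𝕜 μ ω)
    (exists_norm_ofCc_apply_le φ.toContinuousLinearMap) f

end Congr

section OppositeEquiv

variable {𝕜 G A : Type*} [RCLike 𝕜]
  [Group G] [TopologicalSpace G] [IsTopologicalGroup G] [LocallyCompactSpace G] [T2Space G]
  [MeasurableSpace G] [BorelSpace G] [NonUnitalNormedRing A] [NormedSpace 𝕜 A]
  (μ : Measure G) [μ.IsHaarMeasure] [μ.Regular] (ω : Weight G)

namespace DynamicalSystem

variable (α : DynamicalSystem 𝕜 G A) (hα : α.UniformlyBounded)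

/-- The isomorphism `f ↦ (s ↦ Δ(s) α_s(f(s⁻¹)))` from `C_c(G, A)` to `C_c(G, Aᵒᵖ)`, which reverses
twisted convolution. -/
def ccOppositeEquiv : WeightedCc A μ ω ≃L[𝕜] WeightedCc Aᵐᵒᵖ μ ω.inv :=
  ContinuousLinearEquiv.equivOfInverse
    (reflect μ ω ω.inv α hα (opL 𝕜 A) ω.inv_apply)
    (reflect μ ω.inv ω α.opposite hα.opposite (unopL 𝕜 A) fun s => by simp)
    (fun f => WeightedCc.ext fun s => by simp [smul_smul, modular_mul_modular_inv, ← act_mul_apply])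
    (fun f => WeightedCc.ext fun s => by simp [smul_smul, modular_mul_modular_inv, ← act_mul_apply])

@[simp] theorem ccOppositeEquiv_apply (f : WeightedCc A μ ω) (s : G) :
    α.ccOppositeEquiv μ ω hα f s = modular 𝕜 s • op (α.act s (f s⁻¹)) := rfl

section Convolution

variable [NormedSpace ℝ A] [IsScalarTower ℝ 𝕜 A] [IsScalarTower 𝕜 A A] [SMulCommClass 𝕜 A A]
  [CompleteSpace A]

theorem ccOppositeEquiv_conv (f g : WeightedCc A μ ω) :
    α.ccOppositeEquiv μ ω hα (α.conv μ ω hα f g) =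
      α.opposite.conv μ ω.inv hα.opposite (α.ccOppositeEquiv μ ω hα g)
        (α.ccOppositeEquiv μ ω hα f) := by
  refine WeightedCc.ext fun s => ?_
  have hcomm := (opL 𝕜 A ∘L α.act s).integral_comp_comm
    (α.integrable_twist μ hα f.continuous f.hasCompactSupport g.continuous s⁻¹)
  calc α.ccOppositeEquiv μ ω hα (α.conv μ ω hα f g) s
      = ∫ r, modular 𝕜 s • op (α.act s (f r * α.act r (g (r⁻¹ * s⁻¹)))) ∂μ := by
        rw [integral_smul]
        exact congrArg (modular 𝕜 s • ·) hcomm.symm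
    _ = ∫ r, modular 𝕜 s •
          op (α.act s (f (s⁻¹ * r) * α.act (s⁻¹ * r) (g ((s⁻¹ * r)⁻¹ * s⁻¹)))) ∂μ :=
        (integral_mul_left_eq_self _ s⁻¹).symm
    _ = _ := by
        rw [conv_apply]
        refine integral_congr_ae (.of_forall fun r => ?_)
        simp only [ccOppositeEquiv_apply, opposite_act, unop_op, map_smul, smul_mul_smul_comm,
          ← modular_mul, mul_inv_rev, inv_inv, α.act_mul, ← act_mul_apply, op_mul,
          mul_inv_cancel_left, mul_inv_cancel_right]

end Convolution

/-- The isomorphism of `L¹(G, A, ω; α)` with `L¹(G, Aᵒᵖ, ω(·⁻¹); α)` extending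
`ccOppositeEquiv`. -/
def oppositeEquiv : BeurlingSpace A μ ω ≃L[𝕜] BeurlingSpace Aᵐᵒᵖ μ ω.inv :=
  beurlingSpaceCongr (α.ccOppositeEquiv μ ω hα)

theorem oppositeEquiv_ofCc (f : WeightedCc A μ ω) :
    α.oppositeEquiv μ ω hα (ofCc μ ω 𝕜 f) = ofCc μ ω.inv 𝕜 (α.ccOppositeEquiv μ ω hα f) :=
  beurlingSpaceCongr_ofCc _ f

variable [NormedSpace ℝ A] [IsScalarTower ℝ 𝕜 A] [IsScalarTower 𝕜 A A] [SMulCommClass 𝕜 A A]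
  [CompleteSpace A]

theorem oppositeEquiv_beurlingMul (u v : BeurlingSpace A μ ω) :
    α.oppositeEquiv μ ω hα (α.beurlingMul μ ω hα u v) =
      α.opposite.beurlingMul μ ω.inv hα.opposite (α.oppositeEquiv μ ω hα v)
        (α.oppositeEquiv μ ω hα u) := by
  set Φ := α.oppositeEquiv μ ω hα
  refine (denseRange_ofCc 𝕜 μ ω).induction_on₂ (p := fun u v => Φ (α.beurlingMul μ ω hα u v) =
    α.opposite.beurlingMul μ ω.inv hα.opposite (Φ v) (Φ u)) (isClosed_eq ?_ ?_) (fun f g => ?_) u v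
  · exact Φ.continuous.comp (α.beurlingMul μ ω hα).continuous₂
  · exact (α.opposite.beurlingMul μ ω.inv hα.opposite).continuous₂.comp
      ((Φ.continuous.comp continuous_snd).prodMk (Φ.continuous.comp continuous_fst))
  · simp only [Φ, beurlingMul_ofCc, oppositeEquiv_ofCc, ccOppositeEquiv_conv]

end DynamicalSystem

end OppositeEquiv

/-! ### Integrated forms of anti-covariant pairs -/

theorem HasBoundedLeftApproxIdentity.op {A : Type*} [NonUnitalNormedRing A]
    (hA : HasBoundedLeftApproxIdentity fun a b : A => b * a) :
    HasBoundedLeftApproxIdentity fun a b : Aᵐᵒᵖ => a * b := by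
  obtain ⟨l, hl, ⟨M, hM⟩, hlim⟩ := hA
  refine ⟨map MulOpposite.op l, hl.map _, ⟨M, eventually_map.2 hM⟩, fun b => ?_⟩
  rw [tendsto_map'_iff]
  exact (continuous_op.tendsto _).comp (hlim (unop b))

theorem weightBounded_inv_iff {𝕜 G X : Type*} [RCLike 𝕜] [Group G] [TopologicalSpace G]
    [IsTopologicalGroup G] [MeasurableSpace G] [BorelSpace G] [NormedAddCommGroup X]
    [NormedSpace 𝕜 X] {U : G → X →L[𝕜] X} {ω : Weight G} :
    WeightBounded (fun r => U r⁻¹) ω.inv ↔ WeightBounded U ω :=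
  ⟨fun ⟨C, hC⟩ => ⟨C, fun r => by simpa using hC r⁻¹⟩, fun ⟨C, hC⟩ => ⟨C, fun r => hC r⁻¹⟩⟩

section Anti

variable {𝕜 G A X : Type*} [RCLike 𝕜]
  [Group G] [TopologicalSpace G] [IsTopologicalGroup G]
  [NonUnitalNormedRing A] [NormedSpace 𝕜 A] [NormedAddCommGroup X] [NormedSpace 𝕜 X]
  {α : DynamicalSystem 𝕜 G A} {π : A →L[𝕜] X →L[𝕜] X} {U : G → X →L[𝕜] X}

theorem isCovariantRep_opposite_iff :
    IsCovariantRep α.opposite (π.comp (unopL 𝕜 A)) (fun r => U r⁻¹) ↔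
      IsAntiCovariantPair α π U := by
  have hunop : IsNondegenerate (π.comp (unopL 𝕜 A)) ↔ IsNondegenerate π :=
    IsNondegenerate.comp_iff (T := π) unop_surjective.denseRange
  constructor
  · intro h
    refine ⟨fun a b => h.map_mul (op b) (op a), hunop.1 h.nondegenerate, ?_, fun r s => ?_,
      fun x => ?_, fun a r => ?_⟩
    · simpa using h.group_one
    · simpa using h.group_mul s⁻¹ r⁻¹
    · simpa [Function.comp_def] using (h.continuous x).comp continuous_inv
    · simpa using h.covariant (op a) r⁻¹
  · intro h
    refine ⟨fun a b => h.map_mul _ _, hunop.2 h.nondegenerate, ?_, fun r s => ?_,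
      fun x => (h.continuous x).comp continuous_inv, fun a r => ?_⟩
    · simpa using h.group_one
    · rw [mul_inv_rev]
      exact h.group_mul _ _
    · simpa using h.anticovariant (unop a) r⁻¹

theorem IsAntiCovariantPair.apply_apply (h : IsAntiCovariantPair α π U) (r : G) (a : A) (x : X) :
    U r (π a x) = π (α.act r⁻¹ a) (U r x) := by
  simpa using (isCovariantRep_opposite_iff.2 h).apply_apply r⁻¹ (op a) x

variable [LocallyCompactSpace G] [T2Space G] [MeasurableSpace G] [BorelSpace G]
  {μ : Measure G} [μ.IsHaarMeasure] [μ.Regular] {ω : Weight G}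

section IntegratedForm

variable [NormedSpace ℝ X] [IsScalarTower ℝ 𝕜 X] {T : BeurlingSpace A μ ω →L[𝕜] X →L[𝕜] X}

theorem IsAntiCovariantPair.integral_ccOppositeEquiv (h : IsAntiCovariantPair α π U)
    (hα : α.UniformlyBounded) (f : WeightedCc A μ ω) (x : X) :
    ∫ r, π (unop (α.ccOppositeEquiv μ ω hα f r)) (U r⁻¹ x) ∂μ = ∫ r, U r (π (f r) x) ∂μ := by
  have hs : HasCompactSupport fun r => U r (π (f r) x) :=
    f.hasCompactSupport.mono fun r hr h0 => hr (by simp [h0])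
  rw [← integral_modularCharacterFun_smul_inv μ hs]
  refine integral_congr_ae (.of_forall fun r => ?_)
  simp only [h.apply_apply, inv_inv, DynamicalSystem.ccOppositeEquiv_apply, unop_smul, unop_op,
    map_smul, modular, _root_.smul_apply, RCLike.real_smul_eq_coe_smul (K := 𝕜)]

theorem IsAntiCovariantPair.isIntegratedForm_opposite_iff (h : IsAntiCovariantPair α π U)
    (hα : α.UniformlyBounded) :
    IsIntegratedForm (π.comp (unopL 𝕜 A)) (fun r => U r⁻¹)
        (T.comp (α.oppositeEquiv μ ω hα).symm.toContinuousLinearMap) ↔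
      IsAntiIntegratedForm π U T := by
  constructor
  · intro hT f x
    rw [← h.integral_ccOppositeEquiv hα]
    refine Eq.trans ?_ (hT (α.ccOppositeEquiv μ ω hα f) x)
    simp [← α.oppositeEquiv_ofCc μ ω]
  · intro hT f x
    obtain ⟨f, rfl⟩ := (α.ccOppositeEquiv μ ω hα).surjective f
    refine Eq.trans ?_ ((hT f x).trans (h.integral_ccOppositeEquiv hα f x).symm)
    simp [← α.oppositeEquiv_ofCc μ ω]

variable [CompleteSpace X]

theorem IsAntiCovariantPair.existsUnique_isAntiIntegratedForm (h : IsAntiCovariantPair α π U)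
    (hα : α.UniformlyBounded) (hω : WeightBounded U ω) :
    ∃! T : BeurlingSpace A μ ω →L[𝕜] X →L[𝕜] X, IsAntiIntegratedForm π U T := by
  simp only [← h.isIntegratedForm_opposite_iff hα]
  exact ((α.oppositeEquiv μ ω hα).arrowCongr (.refl 𝕜 _)).bijective.existsUnique_iff.1 <|
    existsUnique_isIntegratedForm _ (isCovariantRep_opposite_iff.2 h).continuous
      (weightBounded_inv_iff.2 hω)

variable [IsScalarTower 𝕜 A A] [SMulCommClass 𝕜 A A]

namespace IsAntiIntegratedForm

theorem unique (hT : IsAntiIntegratedForm π U T) (h : IsAntiCovariantPair α π U)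
    {π' : A →L[𝕜] X →L[𝕜] X} {U' : G → X →L[𝕜] X} (hT' : IsAntiIntegratedForm π' U' T)
    (h' : IsAntiCovariantPair α π' U') (hα : α.UniformlyBounded) : π' = π ∧ U' = U := by
  obtain ⟨hπ, hU⟩ := ((h.isIntegratedForm_opposite_iff hα).2 hT).unique
    (isCovariantRep_opposite_iff.2 h) ((h'.isIntegratedForm_opposite_iff hα).2 hT')
    (isCovariantRep_opposite_iff.2 h')
  refine ⟨ContinuousLinearMap.ext fun a => DFunLike.congr_fun hπ (op a), funext fun r => ?_⟩
  simpa using congr_fun hU r⁻¹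

theorem commute_iff (hT : IsAntiIntegratedForm π U T) (h : IsAntiCovariantPair α π U)
    (hα : α.UniformlyBounded) {S : X →L[𝕜] X} :
    (∀ u, S * T u = T u * S) ↔ (∀ a, S * π a = π a * S) ∧ ∀ r, S * U r = U r * S := by
  simpa [(α.oppositeEquiv μ ω hα).surjective.forall, op_surjective.forall,
    inv_surjective.forall (p := fun r => S * U r = U r * S)] using
    ((h.isIntegratedForm_opposite_iff hα).2 hT).commute_iff (isCovariantRep_opposite_iff.2 h)
      (S := S)

end IsAntiIntegratedForm

end IntegratedForm

section Algebra

variable [NormedSpace ℝ A] [IsScalarTower ℝ 𝕜 A] [IsScalarTower 𝕜 A A] [SMulCommClass 𝕜 A A]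
  [CompleteSpace A] {hα : α.UniformlyBounded} {T : BeurlingSpace A μ ω →L[𝕜] X →L[𝕜] X}

theorem isBeurlingRep_opposite_iff :
    IsBeurlingRep α.opposite hα.opposite
        (T.comp (α.oppositeEquiv μ ω hα).symm.toContinuousLinearMap) ↔
      IsBeurlingAntiRep α hα T := by
  set Φ := α.oppositeEquiv μ ω hα
  have hnondeg : IsNondegenerate (T.comp Φ.symm.toContinuousLinearMap) ↔ IsNondegenerate T :=
    IsNondegenerate.comp_iff (T := T) Φ.symm.surjective.denseRange
  have hmul : (∀ u v, T (Φ.symm (α.opposite.beurlingMul μ ω.inv hα.opposite u v)) =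
      T (Φ.symm u) * T (Φ.symm v)) ↔ ∀ u v, T (α.beurlingMul μ ω hα u v) = T v * T u := by
    rw [Φ.surjective.forall₂, forall_comm]
    simp only [Φ, ← α.oppositeEquiv_beurlingMul μ ω, ContinuousLinearEquiv.symm_apply_apply]
  exact ⟨fun h => ⟨hmul.1 h.map_mul, hnondeg.1 h.nondegenerate⟩,
    fun h => ⟨hmul.2 h.map_mul, hnondeg.2 h.nondegenerate⟩⟩

variable [NormedSpace ℝ X] [IsScalarTower ℝ 𝕜 X] [CompleteSpace X]

theorem IsAntiIntegratedForm.isBeurlingAntiRep (hT : IsAntiIntegratedForm π U T)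
    (h : IsAntiCovariantPair α π U) (hα : α.UniformlyBounded) : IsBeurlingAntiRep α hα T :=
  isBeurlingRep_opposite_iff.1 <| ((h.isIntegratedForm_opposite_iff hα).2 hT).isBeurlingRep
    (isCovariantRep_opposite_iff.2 h) hα.opposite

theorem IsBeurlingAntiRep.exists_isAntiIntegratedForm (hT : IsBeurlingAntiRep α hα T)
    (hA : HasBoundedLeftApproxIdentity fun a b : A => b * a) :
    ∃ (π : A →L[𝕜] X →L[𝕜] X) (U : G → X →L[𝕜] X), IsAntiCovariantPair α π U ∧
      WeightBounded U ω ∧ IsAntiIntegratedForm π U T := by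
  obtain ⟨π, U, h, hω, hint⟩ :=
    (isBeurlingRep_opposite_iff.2 hT).exists_isIntegratedForm hA.op
  obtain ⟨π, rfl⟩ : ∃ π', π = π'.comp (unopL 𝕜 A) := ⟨π.comp (opL 𝕜 A), rfl⟩
  obtain ⟨U, rfl⟩ : ∃ U' : G → X →L[𝕜] X, U = fun r => U' r⁻¹ :=
    ⟨fun r => U r⁻¹, by simp only [inv_inv]⟩
  have h := isCovariantRep_opposite_iff.1 h
  exact ⟨π, U, h, weightBounded_inv_iff.1 hω, (h.isIntegratedForm_opposite_iff hα).1 hint⟩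

end Algebra

end Anti

/-! ### Commuting pairs -/

section Commuting

variable {𝕜 G H A B X : Type*} [RCLike 𝕜]
  [Group G] [TopologicalSpace G] [IsTopologicalGroup G] [LocallyCompactSpace G] [T2Space G]
  [MeasurableSpace G] [BorelSpace G]
  [Group H] [TopologicalSpace H] [IsTopologicalGroup H] [LocallyCompactSpace H] [T2Space H]
  [MeasurableSpace H] [BorelSpace H]
  [NonUnitalNormedRing A] [NormedSpace 𝕜 A] [IsScalarTower 𝕜 A A] [SMulCommClass 𝕜 A A]
  [NonUnitalNormedRing B] [NormedSpace 𝕜 B] [IsScalarTower 𝕜 B B] [SMulCommClass 𝕜 B B]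
  [NormedAddCommGroup X] [NormedSpace ℝ X] [NormedSpace 𝕜 X] [IsScalarTower ℝ 𝕜 X]
  [CompleteSpace X]
  {μ : Measure G} [μ.IsHaarMeasure] [μ.Regular] {ω : Weight G}
  {ν : Measure H} [ν.IsHaarMeasure] [ν.Regular] {η : Weight H}
  {α : DynamicalSystem 𝕜 G A} {β : DynamicalSystem 𝕜 H B}
  {πm : A →L[𝕜] X →L[𝕜] X} {Um : G → X →L[𝕜] X} {Tm : BeurlingSpace A μ ω →L[𝕜] X →L[𝕜] X}
  {πa : B →L[𝕜] X →L[𝕜] X} {Ua : H → X →L[𝕜] X} {Ta : BeurlingSpace B ν η →L[𝕜] X →L[𝕜] X}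

theorem mapsCommute_iff_pairsCommute (hTm : IsIntegratedForm πm Um Tm)
    (hm : IsCovariantRep α πm Um) (hTa : IsAntiIntegratedForm πa Ua Ta)
    (ha : IsAntiCovariantPair β πa Ua) (hβ : β.UniformlyBounded) :
    MapsCommute Tm Ta ↔ PairsCommute πm Um πa Ua := by
  have hTm_iff : ∀ S : X →L[𝕜] X, (∀ u, Tm u * S = S * Tm u) ↔
      (∀ a, πm a * S = S * πm a) ∧ ∀ r, Um r * S = S * Um r := fun S => by
    simpa only [eq_comm] using hTm.commute_iff hm (S := S)
  calc MapsCommute Tm Ta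
      ↔ ∀ u, (∀ b, Tm u * πa b = πa b * Tm u) ∧ ∀ s, Tm u * Ua s = Ua s * Tm u :=
        forall_congr' fun u => hTa.commute_iff ha hβ
    _ ↔ (∀ b u, Tm u * πa b = πa b * Tm u) ∧ ∀ s u, Tm u * Ua s = Ua s * Tm u :=
        forall_and.trans (and_congr forall_comm forall_comm)
    _ ↔ PairsCommute πm Um πa Ua := by
        simp only [hTm_iff, PairsCommute, MapsCommute]
        exact ⟨fun h => ⟨fun a b => (h.1 b).1 a, fun a s => (h.2 s).1 a, fun r b => (h.1 b).2 r,
          fun r s => (h.2 s).2 r⟩, fun ⟨hππ, hπU, hUπ, hUU⟩ =>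
            ⟨fun b => ⟨fun a => hππ a b, fun r => hUπ r b⟩,
              fun s => ⟨fun a => hπU a s, fun r => hUU r s⟩⟩⟩

end Commuting

end BeurlingBimodule

end

open BeurlingBimodule in
theorem mainTheorem5_general {𝕜 G H A B X : Type*} [RCLike 𝕜]
    [Group G] [TopologicalSpace G] [IsTopologicalGroup G] [LocallyCompactSpace G] [T2Space G]
    [MeasurableSpace G] [BorelSpace G]
    [Group H] [TopologicalSpace H] [IsTopologicalGroup H] [LocallyCompactSpace H] [T2Space H]
    [MeasurableSpace H] [BorelSpace H]
    [NonUnitalNormedRing A] [NormedSpace ℝ A] [NormedSpace 𝕜 A] [IsScalarTower ℝ 𝕜 A]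
    [IsScalarTower 𝕜 A A] [SMulCommClass 𝕜 A A] [CompleteSpace A]
    [NonUnitalNormedRing B] [NormedSpace ℝ B] [NormedSpace 𝕜 B] [IsScalarTower ℝ 𝕜 B]
    [IsScalarTower 𝕜 B B] [SMulCommClass 𝕜 B B] [CompleteSpace B]
    [NormedAddCommGroup X] [NormedSpace ℝ X] [NormedSpace 𝕜 X] [IsScalarTower ℝ 𝕜 X]
    [CompleteSpace X]
    (μG : MeasureTheory.Measure G) [μG.IsHaarMeasure] [μG.Regular]
    (μH : MeasureTheory.Measure H) [μH.IsHaarMeasure] [μH.Regular]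
    (α : DynamicalSystem 𝕜 G A) (β : DynamicalSystem 𝕜 H B)
    (hα : α.UniformlyBounded) (hβ : β.UniformlyBounded)
    (ω : Weight G) (η : Weight H) :
    (∀ (πm : A →L[𝕜] X →L[𝕜] X) (Um : G → X →L[𝕜] X)
        (πa : B →L[𝕜] X →L[𝕜] X) (Ua : H → X →L[𝕜] X),
      IsCovariantRep α πm Um → WeightBounded Um ω →
      IsAntiCovariantPair β πa Ua → WeightBounded Ua η →
      PairsCommute πm Um πa Ua →
      (∃! Tm : BeurlingSpace A μG ω →L[𝕜] X →L[𝕜] X, IsIntegratedForm πm Um Tm) ∧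
      (∃! Ta : BeurlingSpace B μH η →L[𝕜] X →L[𝕜] X, IsAntiIntegratedForm πa Ua Ta) ∧
      ∀ (Tm : BeurlingSpace A μG ω →L[𝕜] X →L[𝕜] X)
        (Ta : BeurlingSpace B μH η →L[𝕜] X →L[𝕜] X),
        IsIntegratedForm πm Um Tm → IsAntiIntegratedForm πa Ua Ta →
        IsBeurlingRep α hα Tm ∧ IsBeurlingAntiRep β hβ Ta ∧ MapsCommute Tm Ta) ∧
    (HasBoundedLeftApproxIdentity (fun a b : A => a * b) →
      HasBoundedLeftApproxIdentity (fun a b : B => b * a) →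
      ∀ (Tm : BeurlingSpace A μG ω →L[𝕜] X →L[𝕜] X)
        (Ta : BeurlingSpace B μH η →L[𝕜] X →L[𝕜] X),
      IsBeurlingRep α hα Tm → IsBeurlingAntiRep β hβ Ta → MapsCommute Tm Ta →
      ∃ (πm : A →L[𝕜] X →L[𝕜] X) (Um : G → X →L[𝕜] X)
        (πa : B →L[𝕜] X →L[𝕜] X) (Ua : H → X →L[𝕜] X),
        IsCovariantRep α πm Um ∧ WeightBounded Um ω ∧ IsIntegratedForm πm Um Tm ∧
        IsAntiCovariantPair β πa Ua ∧ WeightBounded Ua η ∧ IsAntiIntegratedForm πa Ua Ta ∧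
        PairsCommute πm Um πa Ua ∧
        (∀ (πm' : A →L[𝕜] X →L[𝕜] X) (Um' : G → X →L[𝕜] X),
          IsCovariantRep α πm' Um' → WeightBounded Um' ω → IsIntegratedForm πm' Um' Tm →
          πm' = πm ∧ Um' = Um) ∧
        (∀ (πa' : B →L[𝕜] X →L[𝕜] X) (Ua' : H → X →L[𝕜] X),
          IsAntiCovariantPair β πa' Ua' → WeightBounded Ua' η → IsAntiIntegratedForm πa' Ua' Ta →
          πa' = πa ∧ Ua' = Ua)) := by
  refine ⟨fun πm Um πa Ua hm hmω ha haη hcomm =>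
    ⟨existsUnique_isIntegratedForm πm hm.continuous hmω,
    ha.existsUnique_isAntiIntegratedForm hβ haη, fun Tm Ta hTm hTa => ?_⟩,
    fun hA hB Tm Ta hTm hTa hcomm => ?_⟩
  · exact ⟨hTm.isBeurlingRep hm hα, hTa.isBeurlingAntiRep ha hβ,
      (mapsCommute_iff_pairsCommute hTm hm hTa ha hβ).2 hcomm⟩
  · obtain ⟨πm, Um, hm, hmω, hTm⟩ := hTm.exists_isIntegratedForm hA
    obtain ⟨πa, Ua, ha, haη, hTa⟩ := hTa.exists_isAntiIntegratedForm hB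
    exact ⟨πm, Um, πa, Ua, hm, hmω, hTm, ha, haη, hTa,
      (mapsCommute_iff_pairsCommute hTm hm hTa ha hβ).1 hcomm,
      fun _ _ hm' _ hTm' => hTm.unique hm hTm' hm',
      fun _ _ ha' _ hTa' => hTa.unique ha hTa' ha' hβ⟩

open BeurlingBimodule in
theorem mainTheorem5 {𝕜 G H A B X : Type*} [RCLike 𝕜]
    [Group G] [TopologicalSpace G] [IsTopologicalGroup G] [LocallyCompactSpace G] [T2Space G]
    [MeasurableSpace G] [BorelSpace G]
    [Group H] [TopologicalSpace H] [IsTopologicalGroup H] [LocallyCompactSpace H] [T2Space H]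
    [MeasurableSpace H] [BorelSpace H]
    [NonUnitalNormedRing A] [NormedSpace ℝ A] [NormedSpace 𝕜 A] [IsScalarTower ℝ 𝕜 A]
    [IsScalarTower 𝕜 A A] [SMulCommClass 𝕜 A A] [CompleteSpace A]
    [NonUnitalNormedRing B] [NormedSpace ℝ B] [NormedSpace 𝕜 B] [IsScalarTower ℝ 𝕜 B]
    [IsScalarTower 𝕜 B B] [SMulCommClass 𝕜 B B] [CompleteSpace B]
    [NormedAddCommGroup X] [NormedSpace ℝ X] [NormedSpace 𝕜 X] [IsScalarTower ℝ 𝕜 X]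
    [CompleteSpace X]
    (μG : MeasureTheory.Measure G) [μG.IsHaarMeasure] [μG.Regular]
    (μH : MeasureTheory.Measure H) [μH.IsHaarMeasure] [μH.Regular]
    (α : DynamicalSystem 𝕜 G A) (β : DynamicalSystem 𝕜 H B)
    (hA : HasBoundedApproxIdentity A) (hB : HasBoundedApproxIdentity B)
    (hα : α.UniformlyBounded) (hβ : β.UniformlyBounded)
    (ω : Weight G) (η : Weight H) :
    -- from commuting pairs to commuting representations
    (∀ (πm : A →L[𝕜] X →L[𝕜] X) (Um : G → X →L[𝕜] X)
        (πa : B →L[𝕜] X →L[𝕜] X) (Ua : H → X →L[𝕜] X),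
      IsCovariantRep α πm Um → WeightBounded Um ω →
      IsAntiCovariantPair β πa Ua → WeightBounded Ua η →
      PairsCommute πm Um πa Ua →
      (∃! Tm : BeurlingSpace A μG ω →L[𝕜] X →L[𝕜] X, IsIntegratedForm πm Um Tm) ∧
      (∃! Ta : BeurlingSpace B μH η →L[𝕜] X →L[𝕜] X, IsAntiIntegratedForm πa Ua Ta) ∧
      ∀ (Tm : BeurlingSpace A μG ω →L[𝕜] X →L[𝕜] X)
        (Ta : BeurlingSpace B μH η →L[𝕜] X →L[𝕜] X),
        IsIntegratedForm πm Um Tm → IsAntiIntegratedForm πa Ua Ta →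
        IsBeurlingRep α hα Tm ∧ IsBeurlingAntiRep β hβ Ta ∧ MapsCommute Tm Ta) ∧
    -- every commuting pair of representations arises from unique, necessarily commuting, pairs
    (∀ (Tm : BeurlingSpace A μG ω →L[𝕜] X →L[𝕜] X)
        (Ta : BeurlingSpace B μH η →L[𝕜] X →L[𝕜] X),
      IsBeurlingRep α hα Tm → IsBeurlingAntiRep β hβ Ta → MapsCommute Tm Ta →
      ∃ (πm : A →L[𝕜] X →L[𝕜] X) (Um : G → X →L[𝕜] X)
        (πa : B →L[𝕜] X →L[𝕜] X) (Ua : H → X →L[𝕜] X),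
        IsCovariantRep α πm Um ∧ WeightBounded Um ω ∧ IsIntegratedForm πm Um Tm ∧
        IsAntiCovariantPair β πa Ua ∧ WeightBounded Ua η ∧ IsAntiIntegratedForm πa Ua Ta ∧
        PairsCommute πm Um πa Ua ∧
        (∀ (πm' : A →L[𝕜] X →L[𝕜] X) (Um' : G → X →L[𝕜] X),
          IsCovariantRep α πm' Um' → WeightBounded Um' ω → IsIntegratedForm πm' Um' Tm →
          πm' = πm ∧ Um' = Um) ∧
        (∀ (πa' : B →L[𝕜] X →L[𝕜] X) (Ua' : H → X →L[𝕜] X),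
          IsAntiCovariantPair β πa' Ua' → WeightBounded Ua' η → IsAntiIntegratedForm πa' Ua' Ta →
          πa' = πa ∧ Ua' = Ua)) := by
  have hgen := mainTheorem5_general (X := X) μG μH α β hα hβ ω η
  exact ⟨hgen.1, hgen.2 hA.left hB.right⟩
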